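/- **Theorem 3.** Let $X=(X_1,\dots,X_n)\in\mathbb R^{d\times n}$, $Y\in\mathbb R^n$, let $\mathcal D\subset\mathbb R^d$ be a nonempty closed convex set, and put $p(\xi)=\sum_{i=1}^n\delta_{\mathcal D}(\xi_i)$ for $\xi=(\xi_1;\dots;\xi_n)\in\mathbb R^{dn}$, where $\delta_C$ is the indicator function of $C$ ($0$ on $C$, $+\infty$ elsewhere). Let $A=e_n\otimes I_n-I_n\otimes e_n\in\mathbb R^{n^2\times n}$ and $B=\mathrm{Diag}(B_1,\dots,B_n)\in\mathbb R^{n^2\times dn}$ with $B_i=e_nX_i^T-X^T$. Let $\sigma>0$, let $H_1\in\mathbb R^{n\times n}$, $H_2\in\mathbb R^{dn\times dn}$ be symmetric positive definite, and let $(\tilde\theta,\tilde\xi,\tilde u,\tilde v)\in\mathbb R^n\times\mathbb R^{dn}\times\mathbb R^{n^2}\times\mathbb R^{dn}$. With $\mathrm E_q(x)=\min_y\{q(y)+\frac12\|y-x\|^2\}$ (attained at $\mathrm{Prox}_q(x)$), $\delta_+$ the indicator function of $\mathbb R^{n^2}_+$, and $\|x\|_H^2=\langle x,Hx\rangle$,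 consider the subproblem of minimizing over $\mathbb R^n\times\mathbb R^{dn}$ $$\Phi(\theta,\xi)=\tfrac12\|\theta-Y\|^2+\sigma \mathrm E_p\big(\xi-\tfrac{\tilde v}{\sigma}\big)+\sigma \mathrm E_{\delta_+}\big(A\theta+B\xi-\tfrac{\tilde u}{\sigma}\big)-\tfrac1{2\sigma}\|\tilde u\|^2-\tfrac1{2\sigma}\|\tilde v\|^2+\tfrac1{2\sigma}\|\theta-\tilde\theta\|_{H_1}^2+\tfrac1{2\sigma}\|\xi-\tilde\xi\|_{H_2}^2 .$$ Let $\hat\partial^2\Phi(\theta,\xi)$ be the set of all matrices $$\sigma\begin{pmatrix}A^T\\B^T\end{pmatrix}(I-P)\begin{pmatrix}A&B\end{pmatrix}+\begin{pmatrix}I_n+\frac1\sigma H_1&0\\0&\sigma(I-Q)+\frac1\sigma H_2\end{pmatrix},$$ where $Q$ lies in the Clarke generalized Jacobian $\partial\mathrm{Prox}_p(\xi-\tilde v/\sigma)$ and $P=\mathrm{Diag}(q)$ with, for $\eta=A\theta+B\xi-\tilde u/\sigma$, $q_i=0$ if $\eta_i<0$, $q_i\in[0,1]$ if $\eta_i=0$,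 $q_i=1$ if $\eta_i>0$. Semismooth Newton method, with parameters $\bar\gamma,\delta\in(0,1)$, $\tau\in(0,1]$, $\mu\in(0,\frac12)$ and any starting point $(\theta^0,\xi^0)$. For $j=0,1,2,\dots$: (1) select $\mathcal H_j\in\hat\partial^2\Phi(\theta^j,\xi^j)$ and compute an approximate solution $(\Delta\theta^j,\Delta\xi^j)$ of $\mathcal H_j(\Delta\theta,\Delta\xi)=-\nabla\Phi(\theta^j,\xi^j)$, either exactly (direct method) or as an iterate of the preconditioned conjugate gradient (PCG) method started at $0$ with an arbitrary symmetric positive definite preconditioner, such that $R_j=\mathcal H_j(\Delta\theta^j,\Delta\xi^j)+\nabla\Phi(\theta^j,\xi^j)$ satisfies $\|R_j\|\le\min(\bar\gamma,\|\nabla\Phi(\theta^j,\xi^j)\|^{1+\tau})$; (2) let $m_j$ be the smallest integer $m\ge0$ with $\Phi(\theta^j+\delta^m\Delta\theta^j,\xi^j+\delta^m\Delta\xi^j)\le\Phi(\theta^j,\xi^j)+\mu\delta^m\langle\nabla\Phi(\theta^j,\xi^j),(\Delta\theta^j,\Delta\xi^j)\rangle$; (3) set $(\theta^{j+1},\xi^{j+1})=(\theta^j,\xi^j)+\delta^{m_j}(\Delta\theta^j,\Delta\xi^j)$.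 Suppose that $\mathrm{Prox}_p$ is strongly semismooth with respect to $\partial\mathrm{Prox}_p$, that is, it is locally Lipschitz and, at every $x$, directionally differentiable with $\mathrm{Prox}_p(x+h)-\mathrm{Prox}_p(x)-Vh=O(\|h\|^2)$ as $h\to0$, uniformly in $V\in\partial\mathrm{Prox}_p(x+h)$. Let $\{(\theta^j,\xi^j)\}$ be an infinite sequence generated by the method. Then $\Phi$ has a unique minimizer $(\bar\theta,\bar\xi)$, the sequence $\{(\theta^j,\xi^j)\}$ converges to $(\bar\theta,\bar\xi)$, and $$\|(\theta^{j+1},\xi^{j+1})-(\bar\theta,\bar\xi)\|=O\big(\|(\theta^j,\xi^j)-(\bar\theta,\bar\xi)\|^{1+\tau}\big)\quad(j\to\infty).$$ In particular $\|(\theta^{j+1},\xi^{j+1})-(\bar\theta,\bar\xi)\|=o(\|(\theta^j,\xi^j)-(\bar\theta,\bar\xi)\|)$, and the convergence is quadratic if $\tau=1$. -/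

import Mathlib

open Filter Topology Asymptotics

namespace ConvexRegression

noncomputable section

/-! ### Moreau envelope and proximal mapping -/

section Prox

variable {E : Type*} [NormedAddCommGroup E]

/-- The indicator function `δ_C`: `0` on `C` and `+∞` off `C`. -/
def indicatorFn (C : Set E) (x : E) : EReal :=
  open Classical in if x ∈ C then 0 else ⊤

/-- The objective `q y + ½ ‖y - x‖²` of the problem that defines the Moreau envelope. -/
def proxObjective (q : E → EReal) (x y : E) : EReal :=
  q y + ((1 / 2 * ‖y - x‖ ^ 2 : ℝ) : EReal)

/-- The Moreau envelope `E_q(x) = min_y { q y + ½ ‖y - x‖² }`, which is real-valued when `q` is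
closed proper convex. -/
def moreauEnvelope (q : E → EReal) (x : E) : ℝ :=
  (⨅ y, proxObjective q x y).toReal

/-- `Prox_q(x)`: the minimizer of `q y + ½ ‖y - x‖²` over `y` (it exists and is unique when `q` is
closed proper convex on a Euclidean space). -/
def prox (q : E → EReal) (x : E) : E :=
  Classical.epsilon fun y => ∀ w, proxObjective q x y ≤ proxObjective q x w

end Prox

/-! ### Clarke generalized Jacobian and strong semismoothness -/

section Semismooth

variable {ι : Type*} [Fintype ι] [DecidableEq ι]

/-- The Clarke generalized Jacobian of `F` at `x`: the convex hull of all limits of Jacobian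
matrices of `F` along sequences of differentiability points that converge to `x`. -/
def clarkeJacobian (F : EuclideanSpace ℝ ι → EuclideanSpace ℝ ι) (x : EuclideanSpace ℝ ι) :
    Set (Matrix ι ι ℝ) :=
  convexHull ℝ {V | ∃ (u : ℕ → EuclideanSpace ℝ ι) (J : ℕ → Matrix ι ι ℝ),
    Tendsto u atTop (𝓝 x) ∧
    (∀ k, HasFDerivAt F (Matrix.toEuclideanCLM (n := ι) (𝕜 := ℝ) (J k)) (u k)) ∧
    Tendsto J atTop (𝓝 V)}

/-- `F` is strongly semismooth (everywhere) with respect to the multifunction `K`: it is locally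
Lipschitz, directionally differentiable at every `x`, and
`F (x + h) - F x - V h = O(‖h‖²)` as `h → 0`, uniformly in `V ∈ K (x + h)`. -/
def StronglySemismooth (F : EuclideanSpace ℝ ι → EuclideanSpace ℝ ι)
    (K : EuclideanSpace ℝ ι → Set (Matrix ι ι ℝ)) : Prop :=
  LocallyLipschitz F ∧
  ∀ x : EuclideanSpace ℝ ι,
    (∀ h : EuclideanSpace ℝ ι, ∃ L : EuclideanSpace ℝ ι,
      Tendsto (fun t : ℝ => t⁻¹ • (F (x + t • h) - F x)) (𝓝[>] 0) (𝓝 L)) ∧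
    (∃ C : ℝ, ∃ ε > 0, ∀ h : EuclideanSpace ℝ ι, ‖h‖ < ε → ∀ V ∈ K (x + h),
      ‖F (x + h) - F x - Matrix.toEuclideanLin V h‖ ≤ C * ‖h‖ ^ 2)

end Semismooth

/-! ### The preconditioned conjugate gradient method -/

section PCG

variable {ι : Type*} [Fintype ι] [DecidableEq ι]

/-- Current iterate, residual and search direction of the PCG method. -/
structure PCGState (ι : Type*) where
  /-- the iterate -/
  x : EuclideanSpace ℝ ι
  /-- the residual `b - H x` -/
  r : EuclideanSpace ℝ ι
  /-- the conjugate search direction -/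
  s : EuclideanSpace ℝ ι

/-- One step of PCG for a system with matrix `H` and preconditioner `M`. If the residual is
already zero, then the iterate does not change any more (`0 / a = 0`). -/
def pcgStep (H M : Matrix ι ι ℝ) (c : PCGState ι) : PCGState ι :=
  let Hs := Matrix.toEuclideanLin H c.s
  let ρ := inner ℝ c.r (Matrix.toEuclideanLin M⁻¹ c.r)
  let a := ρ / inner ℝ c.s Hs
  let r' := c.r - a • Hs
  let y' := Matrix.toEuclideanLin M⁻¹ r'
  { x := c.x + a • c.s
    r := r'
    s := y' + (inner ℝ r' y' / ρ) • c.s }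

/-- The iterates of PCG for `H x = b` with preconditioner `M`, started at `x = 0`. -/
def pcg (H M : Matrix ι ι ℝ) (b : EuclideanSpace ℝ ι) : ℕ → PCGState ι
  | 0 => { x := 0, r := b, s := Matrix.toEuclideanLin M⁻¹ b }
  | k + 1 => pcgStep H M (pcg H M b k)

/-- `x` is produced for the system `H x = b` by a direct method (exact solution) or by finitely
many steps of PCG, started at zero, with some symmetric positive definite preconditioner. -/
def DirectOrPCG (H : Matrix ι ι ℝ) (b x : EuclideanSpace ℝ ι) : Prop :=
  Matrix.toEuclideanLin H x = b ∨
    ∃ M : Matrix ι ι ℝ, M.PosDef ∧ ∃ k : ℕ, x = (pcg H M b k).x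

end PCG

/-! ### The proxALM subproblem -/

/-- The vector `(θ, ξ) ∈ ℝⁿ × ℝ^{dn}` is indexed by `Fin n ⊕ Fin n × Fin d`; the entry `(i, k)` of
`ξ` is the `k`-th coordinate of the block `ξ_i ∈ ℝ^d`. -/
abbrev Var (n d : ℕ) : Type := EuclideanSpace ℝ (Fin n ⊕ Fin n × Fin d)

variable {n d : ℕ}

/-- The component `θ` of `(θ, ξ)`. -/
def thetaPart (z : Var n d) : EuclideanSpace ℝ (Fin n) :=
  WithLp.toLp 2 fun i => z (Sum.inl i)

/-- The component `ξ` of `(θ, ξ)`. -/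
def xiPart (z : Var n d) : EuclideanSpace ℝ (Fin n × Fin d) :=
  WithLp.toLp 2 fun q => z (Sum.inr q)

/-- The block `ξ_i ∈ ℝ^d` of `ξ ∈ ℝ^{dn}`. -/
def block (ξ : EuclideanSpace ℝ (Fin n × Fin d)) (i : Fin n) : EuclideanSpace ℝ (Fin d) :=
  WithLp.toLp 2 fun k => ξ (i, k)

/-- `A = e_n ⊗ I_n - I_n ⊗ e_n`, so `(A θ)_{(i,j)} = θ_j - θ_i`. -/
def matA (n : ℕ) : Matrix (Fin n × Fin n) (Fin n) ℝ :=
  Matrix.of fun r k => (1 : Matrix (Fin n) (Fin n) ℝ) r.2 k - (1 : Matrix (Fin n) (Fin n) ℝ) r.1 k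

/-- `B = Diag(B_1, …, B_n)` with `B_i = e_n X_iᵀ - Xᵀ`, so `(B ξ)_{(i,j)} = ⟨ξ_i, X_i - X_j⟩`. The
data points `X_i` are the columns of `X`. -/
def matB (X : Matrix (Fin d) (Fin n) ℝ) : Matrix (Fin n × Fin n) (Fin n × Fin d) ℝ :=
  Matrix.of fun r q => if r.1 = q.1 then X q.2 r.1 - X q.2 r.2 else 0

/-- `p(ξ) = ∑ i, δ_𝒟(ξ_i)`. -/
def penalty (n : ℕ) (D : Set (EuclideanSpace ℝ (Fin d))) (ξ : EuclideanSpace ℝ (Fin n × Fin d)) :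
    EReal :=
  ∑ i, indicatorFn D (block ξ i)

/-- The nonnegative orthant. -/
def orthant (ι : Type*) : Set (EuclideanSpace ℝ ι) := {η | ∀ i, 0 ≤ η i}

/-- `‖x‖_H² = ⟨x, H x⟩`. -/
def normSqH {ι : Type*} [Fintype ι] [DecidableEq ι] (H : Matrix ι ι ℝ) (x : EuclideanSpace ℝ ι) :
    ℝ :=
  inner ℝ x (Matrix.toEuclideanLin H x)

/-- The data of a proxALM subproblem: data points `X, Y`, the set `𝒟`, the proximal matrices
`H₁, H₂`, the penalty parameter `σ` and the current `(θ̃, ξ̃, ũ, ṽ)`. -/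
structure Subproblem (n d : ℕ) where
  /-- the data points `X_i ∈ ℝ^d`, as columns -/
  X : Matrix (Fin d) (Fin n) ℝ
  /-- the observations -/
  Y : EuclideanSpace ℝ (Fin n)
  /-- the set in which the subgradients are constrained to lie -/
  D : Set (EuclideanSpace ℝ (Fin d))
  /-- the proximal matrix for `θ` -/
  H₁ : Matrix (Fin n) (Fin n) ℝ
  /-- the proximal matrix for `ξ` -/
  H₂ : Matrix (Fin n × Fin d) (Fin n × Fin d) ℝ
  /-- the penalty parameter -/
  σ : ℝ
  /-- `θ̃` -/
  θt : EuclideanSpace ℝ (Fin n)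
  /-- `ξ̃` -/
  ξt : EuclideanSpace ℝ (Fin n × Fin d)
  /-- `ũ` -/
  ut : EuclideanSpace ℝ (Fin n × Fin n)
  /-- `ṽ` -/
  vt : EuclideanSpace ℝ (Fin n × Fin d)

namespace Subproblem

variable (S : Subproblem n d)

/-- `p` -/
def p : EuclideanSpace ℝ (Fin n × Fin d) → EReal := penalty n S.D

/-- `A θ + B ξ - u / σ` -/
def slack (θ : EuclideanSpace ℝ (Fin n)) (ξ : EuclideanSpace ℝ (Fin n × Fin d))
    (u : EuclideanSpace ℝ (Fin n × Fin n)) : EuclideanSpace ℝ (Fin n × Fin n) :=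
  Matrix.toEuclideanLin (matA n) θ + Matrix.toEuclideanLin (matB S.X) ξ - S.σ⁻¹ • u

/-- The augmented Lagrangian `ℒ_σ(θ, ξ; u, v)`. -/
def augLagrangian (θ : EuclideanSpace ℝ (Fin n)) (ξ : EuclideanSpace ℝ (Fin n × Fin d))
    (u : EuclideanSpace ℝ (Fin n × Fin n)) (v : EuclideanSpace ℝ (Fin n × Fin d)) : ℝ :=
  1 / 2 * ‖θ - S.Y‖ ^ 2
    + S.σ * moreauEnvelope S.p (ξ - S.σ⁻¹ • v)
    + S.σ * moreauEnvelope (indicatorFn (orthant (Fin n × Fin n))) (S.slack θ ξ u)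
    - 1 / (2 * S.σ) * ‖u‖ ^ 2 - 1 / (2 * S.σ) * ‖v‖ ^ 2

/-- The objective of the subproblem,
`Φ(θ, ξ) = ℒ_σ(θ, ξ; ũ, ṽ) + ‖θ - θ̃‖²_{H₁} / (2σ) + ‖ξ - ξ̃‖²_{H₂} / (2σ)`. -/
def Phi (z : Var n d) : ℝ :=
  S.augLagrangian (thetaPart z) (xiPart z) S.ut S.vt
    + 1 / (2 * S.σ) * normSqH S.H₁ (thetaPart z - S.θt)
    + 1 / (2 * S.σ) * normSqH S.H₂ (xiPart z - S.ξt)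

end Subproblem

/-- The generalized Jacobian `∂Π₊(η)` of the projection onto the nonnegative orthant: all `Diag(q)`
with `q_i = 0` if `η_i < 0`, `q_i ∈ [0,1]` if `η_i = 0`, and `q_i = 1` if `η_i > 0`. -/
def jacobianOrthant {ι : Type*} [DecidableEq ι] (η : EuclideanSpace ℝ ι) : Set (Matrix ι ι ℝ) :=
  {P | ∃ q : ι → ℝ, P = Matrix.diagonal q ∧
    ∀ i, (η i < 0 → q i = 0) ∧ (η i = 0 → q i ∈ Set.Icc 0 1) ∧ (0 < η i → q i = 1)}

namespace Subproblem

variable (S : Subproblem n d)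

/-- The generalized Hessian `∂̂²Φ(θ, ξ)`: all matrices
`σ (A B)ᵀ (I - P) (A B) + Diag(I + H₁ / σ, σ (I - Q) + H₂ / σ)` with
`P ∈ ∂Π₊(A θ + B ξ - ũ / σ)` and `Q ∈ ∂Prox_p(ξ - ṽ / σ)`. -/
def genHessian (z : Var n d) :
    Set (Matrix (Fin n ⊕ Fin n × Fin d) (Fin n ⊕ Fin n × Fin d) ℝ) :=
  {H | ∃ P ∈ jacobianOrthant (S.slack (thetaPart z) (xiPart z) S.ut),
    ∃ Q ∈ clarkeJacobian (prox S.p) (xiPart z - S.σ⁻¹ • S.vt),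
      H = S.σ • ((Matrix.fromCols (matA n) (matB S.X)).transpose * (1 - P)
            * Matrix.fromCols (matA n) (matB S.X))
          + Matrix.fromBlocks (1 + S.σ⁻¹ • S.H₁) 0 0 (S.σ • (1 - Q) + S.σ⁻¹ • S.H₂)}

/-- One iteration, from `z = (θ^j, ξ^j)` to `z' = (θ^{j+1}, ξ^{j+1})`, of the semismooth Newton
method with parameters `γ` (tolerance), `τ`, `δ` (backtracking factor) and `μ` (Armijo). -/
def SSNStep (γ τ δ μ : ℝ) (z z' : Var n d) : Prop :=
  ∃ H ∈ S.genHessian z, ∃ Δ : Var n d,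
    DirectOrPCG H (-gradient S.Phi z) Δ ∧
    ‖Matrix.toEuclideanLin H Δ + gradient S.Phi z‖ ≤ min γ (‖gradient S.Phi z‖ ^ (1 + τ)) ∧
    ∃ m : ℕ,
      IsLeast {m : ℕ | S.Phi (z + δ ^ m • Δ) ≤
        S.Phi z + μ * δ ^ m * inner ℝ (gradient S.Phi z) Δ} m ∧
      z' = z + δ ^ m • Δ

end Subproblem

end

end ConvexRegression

open ConvexRegression

/-
Since `x ↦ x - Prox(x)` is firmly nonexpansive for a projection and `H₂` is positive definite, `∇Φ`
is strongly monotone and Lipschitz, and every generalized Hessian is uniformly positive definite.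
The residual of a conjugate gradient iterate is orthogonal to the iterate, so every inexact Newton
direction is a descent direction; the line search then forces `∇Φ(zⱼ) → 0`, and strong monotonicity
turns this into convergence to the zero `z̄` of `∇Φ`. Near `z̄`, strong semismoothness makes `z + Δ`
satisfy `‖z + Δ - z̄‖ = O(‖z - z̄‖ ^ (1 + τ))`. The function `Φ` need not be twice differentiable at
`z̄`, but `∇Φ` has a Bouligand derivative there, which expands `Φ` to second order; as `μ < 1 / 2`,
the unit step eventually passes the line search and inherits this rate.
-/

namespace ConvexRegression

open scoped InnerProductSpace NNReal

section PCG

variable {ι : Type*} [Fintype ι] [DecidableEq ι]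

theorem inner_toEuclideanLin_comm {M : Matrix ι ι ℝ} (hM : M.IsHermitian)
    (v w : EuclideanSpace ℝ ι) :
    ⟪Matrix.toEuclideanLin M v, w⟫_ℝ = ⟪v, Matrix.toEuclideanLin M w⟫_ℝ :=
  Matrix.isSymmetric_toEuclideanLin_iff.mpr hM v w

theorem inner_toEuclideanLin_self_pos {M : Matrix ι ι ℝ} (hM : M.PosDef)
    {v : EuclideanSpace ℝ ι} (hv : v ≠ 0) : 0 < ⟪v, Matrix.toEuclideanLin M v⟫_ℝ := by
  have h := hM.dotProduct_mulVec_pos (x := v.ofLp) (by simpa using hv)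
  simpa [EuclideanSpace.inner_eq_star_dotProduct, Matrix.toLpLin_apply, dotProduct_comm] using h

/-- The number `⟪r_k, M⁻¹ r_k⟫`, in which `r_k` is the `k`-th PCG residual. -/
noncomputable def pcgRho (H M : Matrix ι ι ℝ) (b : EuclideanSpace ℝ ι) (k : ℕ) : ℝ :=
  ⟪(pcg H M b k).r, Matrix.toEuclideanLin M⁻¹ (pcg H M b k).r⟫_ℝ

/-- The step length of PCG along its `k`-th search direction. It is `0` when that direction is `0`,
because Lean divides by `0` with value `0`. -/
noncomputable def pcgStepLength (H M : Matrix ι ι ℝ) (b : EuclideanSpace ℝ ι) (k : ℕ) : ℝ :=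
  pcgRho H M b k / ⟪(pcg H M b k).s, Matrix.toEuclideanLin H (pcg H M b k).s⟫_ℝ

/-- The classical relations between the `k`-th PCG state and the earlier ones: the residual is
orthogonal, and the search direction `H`-conjugate, to all earlier search directions. -/
structure PCGInvariant (H M : Matrix ι ι ℝ) (b : EuclideanSpace ℝ ι) (k : ℕ) : Prop where
  residual : (pcg H M b k).r = b - Matrix.toEuclideanLin H (pcg H M b k).x
  direction_eq_zero : (pcg H M b k).r = 0 → (pcg H M b k).s = 0
  inner_direction : ⟪(pcg H M b k).r, (pcg H M b k).s⟫_ℝ = pcgRho H M b k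
  orthogonal : ∀ i < k, ⟪(pcg H M b k).r, (pcg H M b i).s⟫_ℝ = 0
  conjugate : ∀ i < k, ⟪(pcg H M b k).s, Matrix.toEuclideanLin H (pcg H M b i).s⟫_ℝ = 0

variable {H M : Matrix ι ι ℝ} {b : EuclideanSpace ℝ ι} {k : ℕ}

theorem pcg_succ_x (k : ℕ) : (pcg H M b (k + 1)).x =
    (pcg H M b k).x + pcgStepLength H M b k • (pcg H M b k).s := rfl

theorem pcg_succ_r (k : ℕ) : (pcg H M b (k + 1)).r =
    (pcg H M b k).r - pcgStepLength H M b k • Matrix.toEuclideanLin H (pcg H M b k).s := rfl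

theorem pcg_succ_s (k : ℕ) : (pcg H M b (k + 1)).s =
    Matrix.toEuclideanLin M⁻¹ (pcg H M b (k + 1)).r +
      (pcgRho H M b (k + 1) / pcgRho H M b k) • (pcg H M b k).s := rfl

theorem inner_preconditioned_residual_eq_zero {w : EuclideanSpace ℝ ι}
    (hw : ∀ i ≤ k, ⟪w, (pcg H M b i).s⟫_ℝ = 0) {i : ℕ} (hi : i ≤ k) :
    ⟪w, Matrix.toEuclideanLin M⁻¹ (pcg H M b i).r⟫_ℝ = 0 := by
  cases i with
  | zero => exact hw 0 hi
  | succ i =>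
    have h := hw (i + 1) hi
    rwa [pcg_succ_s, inner_add_right, inner_smul_right, hw i (by lia), mul_zero, add_zero] at h

namespace PCGInvariant

theorem pcgRho_ne_zero (h : PCGInvariant H M b k) (hM : M.PosDef) (hs : (pcg H M b k).s ≠ 0) :
    pcgRho H M b k ≠ 0 :=
  (inner_toEuclideanLin_self_pos hM.inv fun hr => hs (h.direction_eq_zero hr)).ne'

theorem stepLength_mul_inner (h : PCGInvariant H M b k) (hH : H.PosDef) :
    pcgStepLength H M b k * ⟪(pcg H M b k).s, Matrix.toEuclideanLin H (pcg H M b k).s⟫_ℝ =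
      pcgRho H M b k := by
  by_cases hs : (pcg H M b k).s = 0
  · rw [← h.inner_direction, hs]
    simp
  · exact div_mul_cancel₀ _ (inner_toEuclideanLin_self_pos hH hs).ne'

theorem stepLength_ne_zero (h : PCGInvariant H M b k) (hH : H.PosDef) (hM : M.PosDef)
    (hs : (pcg H M b k).s ≠ 0) : pcgStepLength H M b k ≠ 0 :=
  left_ne_zero_of_mul (h.stepLength_mul_inner hH ▸ h.pcgRho_ne_zero hM hs)

theorem orthogonal_succ (h : PCGInvariant H M b k) (hH : H.PosDef) {i : ℕ} (hi : i ≤ k) :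
    ⟪(pcg H M b (k + 1)).r, (pcg H M b i).s⟫_ℝ = 0 := by
  rw [pcg_succ_r, inner_sub_left, real_inner_smul_left, inner_toEuclideanLin_comm hH.isHermitian]
  rcases hi.lt_or_eq with hlt | rfl
  · rw [h.orthogonal i hlt, h.conjugate i hlt, mul_zero, sub_zero]
  · rw [h.inner_direction, h.stepLength_mul_inner hH, sub_self]

theorem conjugate_succ (h : ∀ i ≤ k, PCGInvariant H M b i) (hH : H.PosDef) (hM : M.PosDef)
    {i : ℕ} (hi : i ≤ k) :
    ⟪(pcg H M b (k + 1)).s, Matrix.toEuclideanLin H (pcg H M b i).s⟫_ℝ = 0 := by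
  by_cases hs : (pcg H M b i).s = 0
  · simp [hs]
  have hy : ∀ j ≤ k, ⟪Matrix.toEuclideanLin M⁻¹ (pcg H M b (k + 1)).r, (pcg H M b j).r⟫_ℝ = 0 :=
    fun j hj => by
      rw [inner_toEuclideanLin_comm hM.inv.isHermitian]
      exact inner_preconditioned_residual_eq_zero (fun _ => (h k le_rfl).orthogonal_succ hH) hj
  have hstep : pcgStepLength H M b i • Matrix.toEuclideanLin H (pcg H M b i).s =
      (pcg H M b i).r - (pcg H M b (i + 1)).r := by rw [pcg_succ_r, sub_sub_cancel]
  refine (mul_eq_zero.mp ?_).resolve_left ((h i hi).stepLength_ne_zero hH hM hs)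
  rw [pcg_succ_s, inner_add_left, mul_add, ← real_inner_smul_right, hstep, inner_sub_right,
    hy i hi, real_inner_smul_left]
  rcases hi.lt_or_eq with hlt | rfl
  · rw [hy (i + 1) hlt, (h k le_rfl).conjugate i hlt]
    ring
  · rw [inner_toEuclideanLin_comm hM.inv.isHermitian, mul_left_comm,
      (h i le_rfl).stepLength_mul_inner hH, div_mul_cancel₀ _ ((h i le_rfl).pcgRho_ne_zero hM hs)]
    simp [pcgRho]

end PCGInvariant

theorem pcgInvariant (hH : H.PosDef) (hM : M.PosDef) (k : ℕ) : PCGInvariant H M b k := by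
  induction k using Nat.strong_induction_on with
  | _ k ih =>
  cases k with
  | zero =>
    refine ⟨by simp [pcg], fun h => ?_, rfl, by simp, by simp⟩
    have hb : b = 0 := h
    simp [pcg, hb]
  | succ k =>
    have hk := ih k k.lt_succ_self
    refine ⟨?_, fun hr => ?_, ?_, fun i hi => hk.orthogonal_succ hH (Nat.lt_succ_iff.mp hi),
      fun i hi => PCGInvariant.conjugate_succ (fun j hj => ih j (Nat.lt_succ_iff.mpr hj)) hH hM
        (Nat.lt_succ_iff.mp hi)⟩
    · rw [pcg_succ_r, pcg_succ_x, hk.residual, map_add, map_smul]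
      abel
    · simp [pcg_succ_s, pcgRho, hr]
    · rw [pcg_succ_s, inner_add_right, inner_smul_right, hk.orthogonal_succ hH le_rfl, mul_zero,
        add_zero, pcgRho]

theorem pcg_residual_inner_iterate (hH : H.PosDef) (hM : M.PosDef) {j k : ℕ} (hjk : j ≤ k) :
    ⟪(pcg H M b k).r, (pcg H M b j).x⟫_ℝ = 0 := by
  induction j with
  | zero => simp [pcg]
  | succ j ih =>
    rw [pcg_succ_x, inner_add_right, inner_smul_right, ih (by lia),
      (pcgInvariant hH hM k).orthogonal j hjk, mul_zero, add_zero]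

theorem DirectOrPCG.inner_residual (hH : H.PosDef) {x : EuclideanSpace ℝ ι}
    (hx : DirectOrPCG H b x) : ⟪Matrix.toEuclideanLin H x - b, x⟫_ℝ = 0 := by
  rcases hx with hx | ⟨M, hM, k, rfl⟩
  · rw [hx, sub_self, inner_zero_left]
  · rw [← neg_sub, ← (pcgInvariant hH hM k).residual, inner_neg_left,
      pcg_residual_inner_iterate hH hM le_rfl, neg_zero]

end PCG

section BouligandDerivative

variable {E G : Type*} [NormedAddCommGroup E] [NormedSpace ℝ E]
  [NormedAddCommGroup G] [NormedSpace ℝ G]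

/-- `D` is the Bouligand derivative of `F` at `x`: a positively homogeneous, possibly nonlinear, map
which approximates `F` at `x` to first order. -/
structure HasBouligandDerivAt (F : E → G) (D : E → G) (x : E) : Prop where
  map_smul : ∀ t : ℝ, 0 < t → ∀ h, D (t • h) = t • D h
  isLittleO : (fun h => F (x + h) - F x - D h) =o[𝓝 0] fun h => h

theorem lipschitzWith_inv_smul_sub {F : E → G} {K : ℝ≥0} (hF : LipschitzWith K F) (x : E) (t : ℝ) :
    LipschitzWith K fun h => t⁻¹ • (F (x + t • h) - F x) := by
  refine LipschitzWith.of_dist_le_mul fun v w => ?_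
  rw [dist_eq_norm, dist_eq_norm, ← smul_sub, sub_sub_sub_cancel_right, norm_smul, norm_inv]
  calc ‖t‖⁻¹ * ‖F (x + t • v) - F (x + t • w)‖
      ≤ ‖t‖⁻¹ * (K * ‖(x + t • v) - (x + t • w)‖) := by gcongr; exact hF.norm_sub_le _ _
    _ = ‖t‖⁻¹ * ‖t‖ * (K * ‖v - w‖) := by
        rw [add_sub_add_left_eq_sub, ← smul_sub, norm_smul]; ring
    _ ≤ K * ‖v - w‖ := mul_le_of_le_one_left (by positivity) inv_mul_le_one

theorem map_smul_of_tendsto_inv_smul_sub {F D : E → G} {x : E}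
    (hD : ∀ h, Tendsto (fun t : ℝ => t⁻¹ • (F (x + t • h) - F x)) (𝓝[>] 0) (𝓝 (D h)))
    {a : ℝ} (ha : 0 < a) (h : E) : D (a • h) = a • D h := by
  have hmul : Tendsto (fun t : ℝ => t * a) (𝓝[>] 0) (𝓝[>] 0) := by
    refine tendsto_nhdsWithin_of_tendsto_nhds_of_eventually_within _ ?_
      (eventually_mem_nhdsWithin.mono fun t ht => mul_pos ht ha)
    simpa using ((continuous_mul_const a).tendsto 0).mono_left nhdsWithin_le_nhds
  refine tendsto_nhds_unique (hD (a • h)) ((((hD h).comp hmul).const_smul a).congr fun t => ?_)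
  simp only [Function.comp_apply, smul_smul, mul_inv_rev, mul_inv_cancel_left₀ ha.ne']

theorem tendstoUniformlyOn_inv_smul_sub [FiniteDimensional ℝ E] {F D : E → G} {K : ℝ≥0}
    (hF : LipschitzWith K F) {x : E}
    (hD : ∀ h, Tendsto (fun t : ℝ => t⁻¹ • (F (x + t • h) - F x)) (𝓝[>] 0) (𝓝 (D h))) :
    TendstoUniformlyOn (fun (t : ℝ) h => t⁻¹ • (F (x + t • h) - F x)) D (𝓝[>] 0)
      (Metric.sphere 0 1) := by
  rw [tendstoUniformlyOn_iff_tendstoUniformly_comp_coe]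
  have hequi : Equicontinuous fun (t : ℝ) (h : Metric.sphere (0 : E) 1) =>
      t⁻¹ • (F (x + t • (h : E)) - F x) :=
    (LipschitzWith.uniformEquicontinuous _ (K * 1) fun t =>
      (lipschitzWith_inv_smul_sub hF x t).comp (LipschitzWith.subtype_val _)).equicontinuous
  exact UniformFun.tendsto_iff_tendstoUniformly.mp
    ((hequi.tendsto_uniformFun_iff_pi _ _).mpr (tendsto_pi_nhds.mpr fun h => hD h))

theorem exists_hasBouligandDerivAt [FiniteDimensional ℝ E] {F : E → G} {K : ℝ≥0}
    (hF : LipschitzWith K F) {x : E}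
    (hdir : ∀ h, ∃ d, Tendsto (fun t : ℝ => t⁻¹ • (F (x + t • h) - F x)) (𝓝[>] 0) (𝓝 d)) :
    ∃ D, HasBouligandDerivAt F D x := by
  choose D hD using hdir
  have hsmul (t : ℝ) (ht : 0 < t) (h : E) := map_smul_of_tendsto_inv_smul_sub hD ht h
  refine ⟨D, hsmul, isLittleO_iff.mpr fun ε hε => ?_⟩
  obtain ⟨r, hr, hquot⟩ := mem_nhdsGT_iff_exists_Ioo_subset.mp
    (Metric.tendstoUniformlyOn_iff.mp (tendstoUniformlyOn_inv_smul_sub hF hD) ε hε)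
  filter_upwards [Metric.ball_mem_nhds 0 hr] with h hh
  rcases eq_or_ne h 0 with rfl | h0
  · have hD0 : D 0 = 0 := by simpa [two_smul] using hsmul 2 two_pos 0
    simp [hD0]
  have hpos : 0 < ‖h‖ := norm_pos_iff.mpr h0
  have hclose := hquot ⟨hpos, mem_ball_zero_iff.mp hh⟩ (‖h‖⁻¹ • h) (by simp [norm_smul, h0])
  rw [dist_eq_norm, norm_sub_rev, smul_inv_smul₀ hpos.ne', hsmul _ (inv_pos.mpr hpos), ← smul_sub,
    norm_smul, norm_inv, norm_norm, inv_mul_lt_iff₀ hpos, mul_comm] at hclose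
  exact hclose.le

theorem exists_tendsto_inv_smul_residual_sub {F : G → G} {T : E →L[ℝ] G} {b : G} {z h : E}
    (hF : ∃ d, Tendsto (fun t : ℝ => t⁻¹ • (F (T z - b + t • T h) - F (T z - b))) (𝓝[>] 0) (𝓝 d)) :
    ∃ d, Tendsto (fun t : ℝ => t⁻¹ • ((T (z + t • h) - b - F (T (z + t • h) - b)) -
      (T z - b - F (T z - b)))) (𝓝[>] 0) (𝓝 d) := by
  obtain ⟨d, hd⟩ := hF
  refine ⟨T h - d, (hd.const_sub (T h)).congr' ?_⟩
  filter_upwards [self_mem_nhdsWithin] with t ht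
  rw [map_add, map_smul, add_sub_right_comm, sub_sub_sub_comm, add_sub_cancel_left,
    smul_sub t⁻¹ (t • T h), inv_smul_smul₀ (ne_of_gt ht)]

end BouligandDerivative

section Gradient

variable {E : Type*} [NormedAddCommGroup E] [InnerProductSpace ℝ E] [CompleteSpace E]
  {Φ : E → ℝ} {F : E → E}

theorem bregman_le_of_forall_inner_le (hgrad : ∀ x, HasGradientAt Φ (F x) x) {x v : E} {C : ℝ}
    (h : ∀ t ∈ Set.Ioo (0 : ℝ) 1, ⟪F (x + t • v) - F x, v⟫_ℝ ≤ t * C) :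
    Φ (x + v) - Φ x - ⟪F x, v⟫_ℝ ≤ C / 2 := by
  have hline (t : ℝ) : HasDerivAt (fun t : ℝ => Φ (x + t • v)) ⟪F (x + t • v), v⟫_ℝ t := by
    refine ((hgrad (x + t • v)).hasFDerivAt.comp_hasDerivAt t
      (((hasDerivAt_id t).smul_const v).const_add x)).congr_deriv ?_
    simp
  have hparabola (t : ℝ) :
      HasDerivAt (fun t : ℝ => Φ x + t * ⟪F x, v⟫_ℝ + t ^ 2 * (C / 2)) (⟪F x, v⟫_ℝ + t * C) t := by
    refine ((((hasDerivAt_id t).mul_const _).const_add _).add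
      ((hasDerivAt_pow 2 t).mul_const _)).congr_deriv ?_
    simp
    ring
  have hle := image_le_of_deriv_right_le_deriv_boundary (a := 0) (b := 1)
    (fun t _ => (hline t).continuousAt.continuousWithinAt)
    (fun t _ => (hline t).hasDerivWithinAt) (by simp)
    (fun t _ => (hparabola t).continuousAt.continuousWithinAt)
    (fun t _ => (hparabola t).hasDerivWithinAt)
    (fun t ht => by
      rcases ht.1.eq_or_lt with rfl | ht0
      · simp
      · have := h t ⟨ht0, ht.2⟩
        rw [inner_sub_left] at this
        linarith)
    (Set.right_mem_Icc.mpr zero_le_one)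
  simp only [one_smul, one_mul, one_pow] at hle
  linarith

theorem le_bregman_of_forall_le_inner (hgrad : ∀ x, HasGradientAt Φ (F x) x) {x v : E} {C : ℝ}
    (h : ∀ t ∈ Set.Ioo (0 : ℝ) 1, t * C ≤ ⟪F (x + t • v) - F x, v⟫_ℝ) :
    C / 2 ≤ Φ (x + v) - Φ x - ⟪F x, v⟫_ℝ := by
  have hneg (x : E) : HasGradientAt (fun x => -Φ x) (-F x) x := by
    rw [hasGradientAt_iff_hasFDerivAt, map_neg]
    exact (hgrad x).hasFDerivAt.neg
  have := bregman_le_of_forall_inner_le hneg (x := x) (v := v) (C := -C) fun t ht => by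
    rw [neg_sub_neg, ← neg_sub, inner_neg_left]
    linarith [h t ht]
  rw [inner_neg_left] at this
  linarith

theorem bregman_le_of_lipschitzWith (hgrad : ∀ x, HasGradientAt Φ (F x) x) {L : ℝ≥0}
    (hF : LipschitzWith L F) (x v : E) :
    Φ (x + v) - Φ x - ⟪F x, v⟫_ℝ ≤ L / 2 * ‖v‖ ^ 2 := by
  have := bregman_le_of_forall_inner_le hgrad (x := x) (v := v) (C := L * ‖v‖ ^ 2) fun t ht =>
    calc ⟪F (x + t • v) - F x, v⟫_ℝ
        ≤ ‖F (x + t • v) - F x‖ * ‖v‖ := real_inner_le_norm _ _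
      _ ≤ L * ‖x + t • v - x‖ * ‖v‖ := by gcongr; exact hF.norm_sub_le _ _
      _ = t * (L * ‖v‖ ^ 2) := by
          rw [add_sub_cancel_left, norm_smul, Real.norm_of_nonneg ht.1.le]; ring
  linarith

/-- Positive homogeneity of `D` makes the derivative of `Φ` along the ray through `h` affine up to
`o(‖h‖)`, and integrating an affine function along the ray produces the factor `1 / 2`. -/
theorem isLittleO_bregman_sub_half_inner (hgrad : ∀ x, HasGradientAt Φ (F x) x) {D : E → E} {x : E}
    (hD : HasBouligandDerivAt F D x) :
    (fun h => Φ (x + h) - Φ x - ⟪F x, h⟫_ℝ - 1 / 2 * ⟪F (x + h) - F x, h⟫_ℝ)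
      =o[𝓝 0] fun h => ‖h‖ ^ 2 := by
  refine isLittleO_iff.mpr fun ε hε => ?_
  obtain ⟨r, hr, hball⟩ := Metric.eventually_nhds_iff_ball.mp (hD.isLittleO.def hε)
  filter_upwards [Metric.ball_mem_nhds 0 hr] with h hh
  have hD_inner {y : E} (hy : y ∈ Metric.ball 0 r) :
      |⟪F (x + y) - F x, h⟫_ℝ - ⟪D y, h⟫_ℝ| ≤ ε * ‖y‖ * ‖h‖ := by
    rw [← inner_sub_left]
    exact (abs_real_inner_le_norm _ _).trans (by gcongr; exact hball y hy)
  have hray (t : ℝ) (ht : t ∈ Set.Ioo (0 : ℝ) 1) :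
      |⟪F (x + t • h) - F x, h⟫_ℝ - t * ⟪D h, h⟫_ℝ| ≤ t * (ε * ‖h‖ ^ 2) := by
    have hmem : t • h ∈ Metric.ball (0 : E) r := by
      rw [mem_ball_zero_iff, norm_smul, Real.norm_of_nonneg ht.1.le]
      exact (mul_le_of_le_one_left (norm_nonneg h) ht.2.le).trans_lt (mem_ball_zero_iff.mp hh)
    have := hD_inner hmem
    rw [hD.map_smul t ht.1, real_inner_smul_left, norm_smul, Real.norm_of_nonneg ht.1.le] at this
    linarith
  have hend := abs_le.mp (hD_inner hh)
  have hupper := bregman_le_of_forall_inner_le hgrad (x := x) (v := h)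
    (C := ⟪D h, h⟫_ℝ + ε * ‖h‖ ^ 2) fun t ht => by linarith [(abs_le.mp (hray t ht)).2]
  have hlower := le_bregman_of_forall_le_inner hgrad (x := x) (v := h)
    (C := ⟪D h, h⟫_ℝ - ε * ‖h‖ ^ 2) fun t ht => by linarith [(abs_le.mp (hray t ht)).1]
  rw [Real.norm_eq_abs, Real.norm_of_nonneg (by positivity), abs_le]
  constructor <;> linarith [hend.1, hend.2]

end Gradient

section StronglyMonotone

variable {E : Type*} [NormedAddCommGroup E] [InnerProductSpace ℝ E] {c : ℝ} {Φ : E → ℝ} {F : E → E}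

/-- `F` is strongly monotone with modulus `c`; for the gradient of a function this is strong
convexity of the function. -/
def StronglyMonotone (c : ℝ) (F : E → E) : Prop :=
  ∀ x y, c * ‖x - y‖ ^ 2 ≤ ⟪F x - F y, x - y⟫_ℝ

theorem mul_norm_le_of_mul_norm_sq_le_inner {v w : E} (h : c * ‖v‖ ^ 2 ≤ ⟪w, v⟫_ℝ) :
    c * ‖v‖ ≤ ‖w‖ := by
  rcases (norm_nonneg v).eq_or_lt with h0 | h0
  · simp [← h0]
  · refine le_of_mul_le_mul_right ?_ h0
    linarith [h.trans (real_inner_le_norm w v)]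

namespace StronglyMonotone

theorem mul_norm_sub_le (hmono : StronglyMonotone c F) (x y : E) :
    c * ‖x - y‖ ≤ ‖F x - F y‖ :=
  mul_norm_le_of_mul_norm_sq_le_inner (hmono x y)

variable [CompleteSpace E]

theorem le_bregman (hmono : StronglyMonotone c F) (hgrad : ∀ x, HasGradientAt Φ (F x) x)
    (x v : E) : c / 2 * ‖v‖ ^ 2 ≤ Φ (x + v) - Φ x - ⟪F x, v⟫_ℝ := by
  have := le_bregman_of_forall_le_inner hgrad (x := x) (v := v) (C := c * ‖v‖ ^ 2) fun t ht => by
    have h := hmono (x + t • v) x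
    rw [add_sub_cancel_left, norm_smul, Real.norm_of_nonneg ht.1.le, real_inner_smul_right] at h
    exact le_of_mul_le_mul_left (by linarith) ht.1
  linarith

theorem add_le_of_eq_zero (hmono : StronglyMonotone c F) (hgrad : ∀ x, HasGradientAt Φ (F x) x)
    {zbar : E} (hbar : F zbar = 0) (w : E) : Φ zbar + c / 2 * ‖w - zbar‖ ^ 2 ≤ Φ w := by
  have := hmono.le_bregman hgrad zbar (w - zbar)
  rw [add_sub_cancel, hbar, inner_zero_left] at this
  linarith

theorem eq_of_forall_le (hmono : StronglyMonotone c F) (hc : 0 < c)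
    (hgrad : ∀ x, HasGradientAt Φ (F x) x) {zbar : E} (hbar : F zbar = 0) {y : E}
    (hy : ∀ w, Φ y ≤ Φ w) : y = zbar := by
  by_contra hne
  have hpos : 0 < ‖y - zbar‖ := norm_pos_iff.mpr (sub_ne_zero.mpr hne)
  have : 0 < c / 2 * ‖y - zbar‖ ^ 2 := by positivity
  linarith [hmono.add_le_of_eq_zero hgrad hbar y, hy zbar]

end StronglyMonotone

theorem exists_eq_zero_of_stronglyMonotone [ProperSpace E]
    (hmono : StronglyMonotone c F) (hc : 0 < c) (hgrad : ∀ x, HasGradientAt Φ (F x) x) :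
    ∃ zbar, F zbar = 0 := by
  have hcont : Continuous Φ := continuous_iff_continuousAt.mpr fun x => (hgrad x).continuousAt
  have hsublevel : {x | Φ x ≤ Φ 0} ⊆ Metric.closedBall 0 (‖F 0‖ / (c / 2)) := by
    intro x hx
    have hlow := hmono.le_bregman hgrad 0 x
    rw [zero_add] at hlow
    rw [mem_closedBall_zero_iff, le_div_iff₀' (by positivity), ← norm_neg (F 0)]
    refine mul_norm_le_of_mul_norm_sq_le_inner ?_
    rw [inner_neg_left]
    linarith [Set.mem_ofPred_eq ▸ hx]
  obtain ⟨zbar, hmin⟩ := hcont.exists_forall_le_of_isBounded 0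
    (Metric.isBounded_closedBall.subset hsublevel)
  exact ⟨zbar, (InnerProductSpace.toDual ℝ E).map_eq_zero_iff.mp
    (IsLocalMin.hasFDerivAt_eq_zero (.of_forall hmin) (hgrad zbar).hasFDerivAt)⟩

end StronglyMonotone

section NewtonStep

theorem min_rpow_le {γ τ a : ℝ} (hγ : 0 < γ) (hτ : 0 < τ) (ha : 0 ≤ a) :
    min γ (a ^ (1 + τ)) ≤ γ ^ (τ / (1 + τ)) * a := by
  have hτ' : 0 < 1 + τ := by linarith
  have hmin : 0 ≤ min γ (a ^ (1 + τ)) := le_min hγ.le (Real.rpow_nonneg ha _)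
  have hsum : τ / (1 + τ) + 1 / (1 + τ) = 1 := by field_simp; ring
  calc min γ (a ^ (1 + τ))
      = min γ (a ^ (1 + τ)) ^ (τ / (1 + τ)) * min γ (a ^ (1 + τ)) ^ (1 / (1 + τ)) := by
        rw [← Real.rpow_add' hmin (by rw [hsum]; norm_num), hsum, Real.rpow_one]
    _ ≤ γ ^ (τ / (1 + τ)) * (a ^ (1 + τ)) ^ (1 / (1 + τ)) := by
        gcongr
        · exact min_le_left _ _
        · exact min_le_right _ _
    _ = γ ^ (τ / (1 + τ)) * a := by
        rw [← Real.rpow_mul ha, mul_one_div_cancel hτ'.ne', Real.rpow_one]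

theorem tendsto_zero_of_mul_sq_le_sub {a e : ℕ → ℝ} {ω : ℝ} (hω : 0 < ω)
    (ha : BddBelow (Set.range a)) (h : ∀ j, ω * e j ^ 2 ≤ a j - a (j + 1)) :
    Tendsto e atTop (𝓝 0) := by
  have hanti : Antitone a := antitone_nat_of_succ_le fun j => by
    linarith [h j, mul_nonneg hω.le (sq_nonneg (e j))]
  have hlim := tendsto_atTop_ciInf hanti ha
  have hdiff : Tendsto (fun j => a j - a (j + 1)) atTop (𝓝 0) := by
    simpa using hlim.sub (hlim.comp (tendsto_add_atTop_nat 1))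
  have hsq : Tendsto (fun j => e j ^ 2) atTop (𝓝 0) := by
    simpa [hω.ne'] using
      (squeeze_zero (fun j => mul_nonneg hω.le (sq_nonneg (e j))) h hdiff).const_mul ω⁻¹
  rw [tendsto_zero_iff_abs_tendsto_zero]
  simpa [Function.comp_def, Real.sqrt_sq_eq_abs] using (Real.continuous_sqrt.tendsto 0).comp hsq

variable {E : Type*} [NormedAddCommGroup E] [InnerProductSpace ℝ E]

/-- One step from `x` of a Newton method for the minimization of `Φ`, in which `F` stands for the
gradient of `Φ` and `T` for its generalized Hessian: `Δ` is the direction and `m` the Armijo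
backtracking exponent. Exact and PCG solutions `Δ` of the Newton equation are both covered, since
their residuals are orthogonal to `Δ`. -/
structure IsNewtonStep (Φ : E → ℝ) (F : E → E) (γ τ δ μ : ℝ) (T : E →ₗ[ℝ] E) (x Δ : E) (m : ℕ) :
    Prop where
  orthogonal : ⟪T Δ + F x, Δ⟫_ℝ = 0
  residual : ‖T Δ + F x‖ ≤ min γ (‖F x‖ ^ (1 + τ))
  armijo : IsLeast {m : ℕ | Φ (x + δ ^ m • Δ) ≤ Φ x + μ * δ ^ m * ⟪F x, Δ⟫_ℝ} m

namespace IsNewtonStep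

variable {c γ τ δ μ : ℝ} {L : ℝ≥0} {Φ : E → ℝ} {F : E → E} {T : E →ₗ[ℝ] E} {x Δ : E} {m : ℕ}

theorem inner_le (h : IsNewtonStep Φ F γ τ δ μ T x Δ m)
    (hT : ∀ v, c * ‖v‖ ^ 2 ≤ ⟪T v, v⟫_ℝ) : ⟪F x, Δ⟫_ℝ ≤ -(c * ‖Δ‖ ^ 2) := by
  have horth := h.orthogonal
  rw [inner_add_left] at horth
  linarith [hT Δ]

theorem norm_le (h : IsNewtonStep Φ F γ τ δ μ T x Δ m) (hγ : 0 < γ) (hτ : 0 < τ)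
    (hT : ∀ v, ‖T v‖ ≤ L * ‖v‖) : (1 - γ ^ (τ / (1 + τ))) * ‖F x‖ ≤ L * ‖Δ‖ := by
  have hres := h.residual.trans (min_rpow_le hγ hτ (norm_nonneg (F x)))
  have htri : ‖F x‖ ≤ ‖T Δ + F x‖ + ‖T Δ‖ := by
    simpa using norm_sub_le (T Δ + F x) (T Δ)
  linarith [hT Δ]

theorem le_stepLength [CompleteSpace E] (h : IsNewtonStep Φ F γ τ δ μ T x Δ m)
    (hgrad : ∀ x, HasGradientAt Φ (F x) x) (hL : 0 < L) (hF : LipschitzWith L F)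
    (hδ : δ ∈ Set.Ioo (0 : ℝ) 1) (hμ : μ < 1) (hT : ∀ v, c * ‖v‖ ^ 2 ≤ ⟪T v, v⟫_ℝ) :
    min 1 (δ * (2 * (1 - μ) * c / L)) ≤ δ ^ m := by
  cases m with
  | zero => simp
  | succ m =>
    refine (min_le_right _ _).trans ?_
    rw [pow_succ']
    refine mul_le_mul_of_nonneg_left ?_ hδ.1.le
    by_contra! hlt
    refine m.lt_irrefl (h.armijo.2 ?_)
    rw [Set.mem_ofPred_eq]
    have ht : 0 < δ ^ m := pow_pos hδ.1 m
    set t := δ ^ m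
    have hdescent := bregman_le_of_lipschitzWith hgrad hF x (t • Δ)
    rw [real_inner_smul_right, norm_smul, Real.norm_of_nonneg ht.le, mul_pow] at hdescent
    have hquad : L / 2 * (t ^ 2 * ‖Δ‖ ^ 2) ≤ (1 - μ) * t * (c * ‖Δ‖ ^ 2) := by
      calc L / 2 * (t ^ 2 * ‖Δ‖ ^ 2) = t / 2 * (t * L) * ‖Δ‖ ^ 2 := by ring
        _ ≤ t / 2 * (2 * (1 - μ) * c) * ‖Δ‖ ^ 2 := by
          refine mul_le_mul_of_nonneg_right (mul_le_mul_of_nonneg_left ?_ (by positivity))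
            (by positivity)
          exact ((lt_div_iff₀ (by exact_mod_cast hL)).mp hlt).le
        _ = _ := by ring
    have hslope : (1 - μ) * t * ⟪F x, Δ⟫_ℝ ≤ (1 - μ) * t * -(c * ‖Δ‖ ^ 2) :=
      mul_le_mul_of_nonneg_left (h.inner_le hT) (mul_nonneg (by linarith) ht.le)
    linarith

end IsNewtonStep

theorem exists_forall_isNewtonStep_le_sub [CompleteSpace E] {c γ τ δ μ : ℝ} {L : ℝ≥0} {Φ : E → ℝ}
    {F : E → E} (hgrad : ∀ x, HasGradientAt Φ (F x) x) (hL : 0 < L) (hF : LipschitzWith L F)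
    (hc : 0 < c) (hγ : γ ∈ Set.Ioo (0 : ℝ) 1) (hτ : 0 < τ) (hδ : δ ∈ Set.Ioo (0 : ℝ) 1)
    (hμ : μ ∈ Set.Ioo (0 : ℝ) 1) :
    ∃ ω > 0, ∀ (T : E →ₗ[ℝ] E) (x Δ : E) (m : ℕ), (∀ v, c * ‖v‖ ^ 2 ≤ ⟪T v, v⟫_ℝ) →
      (∀ v, ‖T v‖ ≤ L * ‖v‖) → IsNewtonStep Φ F γ τ δ μ T x Δ m →
      ω * ‖F x‖ ^ 2 ≤ Φ x - Φ (x + δ ^ m • Δ) := by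
  have hL' : (0 : ℝ) < L := by exact_mod_cast hL
  set κ := γ ^ (τ / (1 + τ))
  have hκ : 0 < 1 - κ := sub_pos.mpr (Real.rpow_lt_one hγ.1.le hγ.2 (by positivity))
  set t₀ := min 1 (δ * (2 * (1 - μ) * c / L))
  have ht₀ : 0 < t₀ := lt_min one_pos
    (mul_pos hδ.1 (div_pos (mul_pos (mul_pos two_pos (sub_pos.mpr hμ.2)) hc) hL'))
  have hμ₀ := hμ.1
  have hδ₀ := hδ.1
  refine ⟨μ * t₀ * (c * ((1 - κ) / L) ^ 2), by positivity, fun T x Δ m hT hT' h => ?_⟩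
  have hΔ : (1 - κ) / L * ‖F x‖ ≤ ‖Δ‖ := by
    rw [div_mul_eq_mul_div, div_le_iff₀' hL']
    exact h.norm_le hγ.1 hτ hT'
  have harmijo : Φ (x + δ ^ m • Δ) ≤ Φ x + μ * δ ^ m * ⟪F x, Δ⟫_ℝ := h.armijo.1
  calc μ * t₀ * (c * ((1 - κ) / L) ^ 2) * ‖F x‖ ^ 2
      = μ * t₀ * (c * ((1 - κ) / L * ‖F x‖) ^ 2) := by ring
    _ ≤ μ * δ ^ m * (c * ‖Δ‖ ^ 2) := by
        gcongr
        exact h.le_stepLength hgrad hL hF hδ hμ.2 hT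
    _ ≤ μ * δ ^ m * -⟪F x, Δ⟫_ℝ := by
        gcongr
        exact le_neg_of_le_neg (h.inner_le hT)
    _ ≤ Φ x - Φ (x + δ ^ m • Δ) := by linarith

theorem tendsto_of_isNewtonStep [CompleteSpace E] {c γ τ δ μ : ℝ} {L : ℝ≥0} {Φ : E → ℝ}
    {F : E → E} (hgrad : ∀ x, HasGradientAt Φ (F x) x) (hL : 0 < L) (hF : LipschitzWith L F)
    (hc : 0 < c) (hmono : StronglyMonotone c F) (hγ : γ ∈ Set.Ioo (0 : ℝ) 1) (hτ : 0 < τ)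
    (hδ : δ ∈ Set.Ioo (0 : ℝ) 1) (hμ : μ ∈ Set.Ioo (0 : ℝ) 1)
    {z Δ : ℕ → E} {T : ℕ → E →ₗ[ℝ] E} {m : ℕ → ℕ}
    (hT : ∀ j v, c * ‖v‖ ^ 2 ≤ ⟪T j v, v⟫_ℝ) (hT' : ∀ j v, ‖T j v‖ ≤ L * ‖v‖)
    (hstep : ∀ j, IsNewtonStep Φ F γ τ δ μ (T j) (z j) (Δ j) (m j))
    (hz : ∀ j, z (j + 1) = z j + δ ^ m j • Δ j) {zbar : E} (hbar : F zbar = 0) :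
    Tendsto z atTop (𝓝 zbar) := by
  obtain ⟨ω, hω, hdecr⟩ := exists_forall_isNewtonStep_le_sub hgrad hL hF hc hγ hτ hδ hμ
  have hbdd : BddBelow (Set.range fun j => Φ (z j)) := by
    refine ⟨Φ zbar, Set.forall_mem_range.mpr fun j => ?_⟩
    exact (le_add_of_nonneg_right (by positivity)).trans
      (hmono.add_le_of_eq_zero hgrad hbar (z j))
  have hF0 : Tendsto (fun j => ‖F (z j)‖) atTop (𝓝 0) :=
    tendsto_zero_of_mul_sq_le_sub hω hbdd fun j => by
      simpa only [hz j] using hdecr (T j) (z j) (Δ j) (m j) (hT j) (hT' j) (hstep j)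
  rw [tendsto_iff_norm_sub_tendsto_zero]
  refine squeeze_zero (fun j => norm_nonneg _) (fun j => ?_) (by simpa using hF0.const_mul c⁻¹)
  rw [le_inv_mul_iff₀ hc]
  simpa [hbar] using hmono.mul_norm_sub_le (z j) zbar

end NewtonStep

section NewtonDerivative

variable {E G ι : Type*} [NormedAddCommGroup E] [NormedSpace ℝ E]
  [NormedAddCommGroup G] [NormedSpace ℝ G]

/-- The multifunction `K` is a Newton derivative (slanting function) of order `p` for `F` at `x`.
For a Lipschitz continuous, directionally differentiable `F` and its Clarke Jacobian `K`, order `2`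
is strong semismoothness at `x`. -/
def HasNewtonDerivativeAt (p : ℝ) (F : E → G) (K : E → Set (E →ₗ[ℝ] G)) (x : E) : Prop :=
  ∃ C : ℝ, ∀ᶠ y in 𝓝 x, ∀ T ∈ K y, ‖F y - F x - T (y - x)‖ ≤ C * ‖y - x‖ ^ p

namespace HasNewtonDerivativeAt

variable {p q : ℝ} {F : E → G} {K : E → Set (E →ₗ[ℝ] G)} {x : E}

theorem mono (h : HasNewtonDerivativeAt p F K x) (hq : 0 ≤ q) (hqp : q ≤ p) :
    HasNewtonDerivativeAt q F K x := by
  obtain ⟨C, hC⟩ := h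
  refine ⟨|C|, ?_⟩
  filter_upwards [hC, Metric.closedBall_mem_nhds x one_pos] with y hy hball T hT
  calc ‖F y - F x - T (y - x)‖ ≤ C * ‖y - x‖ ^ p := hy T hT
    _ ≤ |C| * ‖y - x‖ ^ q := by
      gcongr ?_ * ?_
      · exact le_abs_self C
      · exact Real.rpow_le_rpow_of_exponent_ge' (norm_nonneg _) (mem_closedBall_iff_norm.mp hball)
          hq hqp

theorem isBigO (h : HasNewtonDerivativeAt p F K x) {l : Filter ι} {z : ι → E}
    (hz : Tendsto z l (𝓝 x)) {T : ι → E →ₗ[ℝ] G} (hT : ∀ i, T i ∈ K (z i)) :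
    (fun i => F (z i) - F x - T i (z i - x)) =O[l] fun i => ‖z i - x‖ ^ p := by
  obtain ⟨C, hC⟩ := h
  refine .of_bound C ?_
  filter_upwards [hz.eventually hC] with i hi
  rw [Real.norm_of_nonneg (by positivity)]
  exact hi (T i) (hT i)

end HasNewtonDerivativeAt

end NewtonDerivative

section LocalRate

variable {E ι : Type*} [NormedAddCommGroup E] {l : Filter ι}

theorem isLittleO_of_isBigO_norm_rpow {G : Type*} [NormedAddCommGroup G] {v : ι → E} {w : ι → G}
    {τ : ℝ} (hτ : 0 < τ) (hv : Tendsto v l (𝓝 0)) (hw : w =O[l] fun i => ‖v i‖ ^ (1 + τ)) :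
    w =o[l] v := by
  have hpow : Tendsto (fun i => ‖v i‖ ^ τ) l (𝓝 0) := by
    simpa [hτ.ne'] using hv.norm.rpow_const (Or.inr hτ.le)
  refine hw.trans_isLittleO ?_
  have := (isBigO_refl (fun i => ‖v i‖) l).mul_isLittleO ((isLittleO_one_iff ℝ).mpr hpow)
  simpa [Real.rpow_add' (norm_nonneg _) (show 1 + τ ≠ 0 by positivity)] using this

variable [InnerProductSpace ℝ E] {c τ : ℝ} {L : ℝ≥0} {F : E → E} {zbar : E}

theorem newton_error_isBigO {z Δ : ι → E} {T : ι → E →ₗ[ℝ] E}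
    (hc : 0 < c) (hT : ∀ i v, c * ‖v‖ ^ 2 ≤ ⟪T i v, v⟫_ℝ) (hF : LipschitzWith L F)
    (hbar : F zbar = 0) (hτ : 0 < τ)
    (hnewton : (fun i => F (z i) - T i (z i - zbar)) =O[l] fun i => ‖z i - zbar‖ ^ (1 + τ))
    (hres : ∀ i, ‖T i (Δ i) + F (z i)‖ ≤ ‖F (z i)‖ ^ (1 + τ)) :
    (fun i => z i + Δ i - zbar) =O[l] fun i => ‖z i - zbar‖ ^ (1 + τ) := by
  have hFz (i : ι) : ‖F (z i)‖ ≤ L * ‖z i - zbar‖ := by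
    simpa [hbar] using hF.norm_sub_le (z i) zbar
  have hres' : (fun i => T i (Δ i) + F (z i)) =O[l] fun i => ‖z i - zbar‖ ^ (1 + τ) := by
    refine .of_bound ((L : ℝ) ^ (1 + τ)) (.of_forall fun i => ?_)
    rw [Real.norm_of_nonneg (by positivity), ← Real.mul_rpow L.coe_nonneg (norm_nonneg _)]
    exact (hres i).trans (Real.rpow_le_rpow (norm_nonneg _) (hFz i) (by positivity))
  have hTw : (fun i => T i (z i + Δ i - zbar)) =O[l] fun i => ‖z i - zbar‖ ^ (1 + τ) := by
    refine (hres'.sub hnewton).congr_left fun i => ?_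
    simp only [map_add, map_sub]
    abel
  refine .trans (.of_bound c⁻¹ (.of_forall fun i => ?_)) hTw
  rw [le_inv_mul_iff₀ hc]
  exact mul_norm_le_of_mul_norm_sq_le_inner (hT i _)

theorem eventually_unit_step_le [CompleteSpace E] {Φ : E → ℝ} {D : E → E} {μ : ℝ} {z Δ : ι → E}
    (hgrad : ∀ x, HasGradientAt Φ (F x) x) (hF : LipschitzWith L F) (hc : 0 < c)
    (hmono : StronglyMonotone c F) (hbar : F zbar = 0) (hD : HasBouligandDerivAt F D zbar)
    (hμ : μ < 1 / 2) (hz : Tendsto z l (𝓝 zbar))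
    (hΔ : (fun i => z i + Δ i - zbar) =o[l] fun i => z i - zbar) :
    ∀ᶠ i in l, Φ (z i + Δ i) ≤ Φ (z i) + μ * ⟪F (z i), Δ i⟫_ℝ := by
  have hupper (i : ι) : Φ (z i + Δ i) - Φ zbar ≤ L / 2 * ‖z i + Δ i - zbar‖ ^ 2 := by
    simpa [hbar] using bregman_le_of_lipschitzWith hgrad hF zbar (z i + Δ i - zbar)
  have hslope (i : ι) : c * ‖z i - zbar‖ ^ 2 ≤ ⟪F (z i), z i - zbar⟫_ℝ := by
    simpa [hbar] using hmono (z i) zbar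
  have hquad : (fun i => Φ (z i) - Φ zbar - 1 / 2 * ⟪F (z i), z i - zbar⟫_ℝ)
      =o[l] fun i => ‖z i - zbar‖ ^ 2 := by
    simpa [hbar, Function.comp_def] using
      (isLittleO_bregman_sub_half_inner hgrad hD).comp_tendsto (tendsto_sub_nhds_zero_iff.mpr hz)
  have hFz : (fun i => F (z i)) =O[l] fun i => z i - zbar :=
    .of_bound L (.of_forall fun i => by simpa [hbar] using hF.norm_sub_le (z i) zbar)
  have hinner : (fun i => ⟪F (z i), z i + Δ i - zbar⟫_ℝ) =o[l] fun i => ‖z i - zbar‖ ^ 2 := by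
    refine (IsBigO.of_norm_le fun i => norm_inner_le_norm (F (z i)) _).trans_isLittleO ?_
    simpa only [sq] using hFz.norm_norm.mul_isLittleO hΔ.norm_norm
  have hsmall := (((hΔ.norm_norm.pow two_pos).const_mul_left (L / 2)).sub hquad).sub
    (hinner.const_mul_left μ)
  filter_upwards [hsmall.def (show 0 < (1 / 2 - μ) * c from mul_pos (sub_pos.mpr hμ) hc)] with i hi
  have hi' := (le_abs_self _).trans hi
  rw [Real.norm_of_nonneg (by positivity)] at hi'
  have hdir : ⟪F (z i), Δ i⟫_ℝ = ⟪F (z i), z i + Δ i - zbar⟫_ℝ - ⟪F (z i), z i - zbar⟫_ℝ := by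
    rw [← inner_sub_right]
    congr 1
    abel
  have := mul_le_mul_of_nonneg_left (hslope i) (sub_pos.mpr hμ).le
  rw [hdir]
  linarith [hupper i]

end LocalRate

section NewtonConvergence

variable {E : Type*} [NormedAddCommGroup E] [InnerProductSpace ℝ E] [CompleteSpace E]
  {c γ τ δ μ : ℝ} {L : ℝ≥0} {Φ : E → ℝ} {F D : E → E} {zbar : E}

theorem isBigO_of_isNewtonStep (hgrad : ∀ x, HasGradientAt Φ (F x) x) (hF : LipschitzWith L F)
    (hc : 0 < c) (hmono : StronglyMonotone c F) (hτ : 0 < τ) (hμ : μ < 1 / 2) {z Δ : ℕ → E}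
    {T : ℕ → E →ₗ[ℝ] E} {m : ℕ → ℕ} (hT : ∀ j v, c * ‖v‖ ^ 2 ≤ ⟪T j v, v⟫_ℝ)
    (hstep : ∀ j, IsNewtonStep Φ F γ τ δ μ (T j) (z j) (Δ j) (m j))
    (hz : ∀ j, z (j + 1) = z j + δ ^ m j • Δ j) (hbar : F zbar = 0)
    (hlim : Tendsto z atTop (𝓝 zbar)) (hD : HasBouligandDerivAt F D zbar)
    (hnewton : (fun j => F (z j) - T j (z j - zbar)) =O[atTop] fun j => ‖z j - zbar‖ ^ (1 + τ)) :
    (fun j => z (j + 1) - zbar) =O[atTop] fun j => ‖z j - zbar‖ ^ (1 + τ) := by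
  have hΔ := newton_error_isBigO hc hT hF hbar hτ hnewton fun j =>
    (hstep j).residual.trans (min_le_right _ _)
  have hunit := eventually_unit_step_le hgrad hF hc hmono hbar hD hμ hlim
    (isLittleO_of_isBigO_norm_rpow hτ (tendsto_sub_nhds_zero_iff.mpr hlim) hΔ)
  refine hΔ.congr' (hunit.mono fun j hj => ?_) .rfl
  have hm : m j = 0 := Nat.le_zero.mp ((hstep j).armijo.2 (by simpa using hj))
  simp [hz, hm]

end NewtonConvergence

section FirmlyNonexpansive

variable {E : Type*} [NormedAddCommGroup E] [InnerProductSpace ℝ E] {F : E → E}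

/-- Firm nonexpansiveness, the property shared by metric projections, by the elements of their
Clarke Jacobians, and by the complements `id - F` of all of these maps. -/
def FirmlyNonexpansive (F : E → E) : Prop :=
  ∀ x y, ‖F x - F y‖ ^ 2 ≤ ⟪F x - F y, x - y⟫_ℝ

theorem norm_sq_le_inner_iff_mem_closedBall {a h : E} :
    ‖a‖ ^ 2 ≤ ⟪a, h⟫_ℝ ↔ a ∈ Metric.closedBall ((1 / 2 : ℝ) • h) (1 / 2 * ‖h‖) := by
  rw [mem_closedBall_iff_norm, ← sq_le_sq₀ (norm_nonneg _) (by positivity), norm_sub_sq_real,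
    real_inner_smul_right, norm_smul, Real.norm_of_nonneg one_half_pos.le]
  constructor <;> intro _ <;> linarith

theorem firmlyNonexpansive_iff_forall_norm_sq_le_inner {T : E →ₗ[ℝ] E} :
    FirmlyNonexpansive T ↔ ∀ v, ‖T v‖ ^ 2 ≤ ⟪T v, v⟫_ℝ :=
  ⟨fun hT v => by simpa using hT v 0, fun hT x y => by simpa only [map_sub] using hT (x - y)⟩

namespace FirmlyNonexpansive

theorem id_sub (hF : FirmlyNonexpansive F) : FirmlyNonexpansive fun x => x - F x := by
  intro x y
  have h := hF x y
  rw [sub_sub_sub_comm, norm_sub_sq_real, inner_sub_left (x - y), real_inner_self_eq_norm_sq,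
    real_inner_comm (F x - F y)]
  linarith

theorem norm_sq_sub_map_le {T : E →ₗ[ℝ] E} (hT : FirmlyNonexpansive T) (v : E) :
    ‖v - T v‖ ^ 2 ≤ ⟪v - T v, v⟫_ℝ := by
  simpa using hT.id_sub v 0

theorem lipschitzWith (hF : FirmlyNonexpansive F) : LipschitzWith 1 F := by
  refine LipschitzWith.of_dist_le_mul fun x y => ?_
  have h := mul_norm_le_of_mul_norm_sq_le_inner (c := 1) (v := F x - F y) (w := x - y) <| by
    rw [one_mul, real_inner_comm]
    exact hF x y
  simpa only [dist_eq_norm, one_mul, NNReal.coe_one] using h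

theorem of_hasFDerivAt (hF : FirmlyNonexpansive F) {T : E →L[ℝ] E} {x : E}
    (hT : HasFDerivAt F T x) : FirmlyNonexpansive T := by
  refine (firmlyNonexpansive_iff_forall_norm_sq_le_inner (T := T.toLinearMap)).mpr fun v => ?_
  rw [norm_sq_le_inner_iff_mem_closedBall]
  refine Metric.isClosed_closedBall.mem_of_tendsto (hT.hasLineDerivAt v).tendsto_slope_zero_right ?_
  filter_upwards [self_mem_nhdsWithin] with t ht
  have ht : 0 < t := ht
  have h := hF (x + t • v) x
  rw [add_sub_cancel_left, real_inner_smul_right] at h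
  rw [← norm_sq_le_inner_iff_mem_closedBall, norm_smul, real_inner_smul_left, mul_pow,
    Real.norm_of_nonneg (by positivity)]
  calc t⁻¹ ^ 2 * ‖F (x + t • v) - F x‖ ^ 2 ≤ t⁻¹ ^ 2 * (t * ⟪F (x + t • v) - F x, v⟫_ℝ) := by gcongr
    _ = t⁻¹ * ⟪F (x + t • v) - F x, v⟫_ℝ := by field_simp

end FirmlyNonexpansive

end FirmlyNonexpansive

section Projection

variable {E : Type*} [NormedAddCommGroup E]

theorem proxObjective_indicatorFn_of_mem {C : Set E} {y : E} (hy : y ∈ C) (x : E) :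
    proxObjective (indicatorFn C) x y = ((1 / 2 * ‖x - y‖ ^ 2 : ℝ) : EReal) := by
  simp [proxObjective, indicatorFn, hy, norm_sub_rev]

theorem proxObjective_indicatorFn_of_notMem {C : Set E} {y : E} (hy : y ∉ C) (x : E) :
    proxObjective (indicatorFn C) x y = ⊤ := by
  simp only [proxObjective, indicatorFn, hy, if_false]
  exact EReal.top_add_coe _

theorem forall_proxObjective_indicatorFn_le_iff {C : Set E} (hne : C.Nonempty) {x y : E} :
    (∀ w, proxObjective (indicatorFn C) x y ≤ proxObjective (indicatorFn C) x w) ↔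
      y ∈ C ∧ ∀ w ∈ C, ‖x - y‖ ≤ ‖x - w‖ := by
  have hle {w : E} (hy : y ∈ C) (hw : w ∈ C) :
      proxObjective (indicatorFn C) x y ≤ proxObjective (indicatorFn C) x w ↔
        ‖x - y‖ ≤ ‖x - w‖ := by
    rw [proxObjective_indicatorFn_of_mem hy, proxObjective_indicatorFn_of_mem hw,
      EReal.coe_le_coe_iff, mul_le_mul_iff_right₀ one_half_pos,
      sq_le_sq₀ (norm_nonneg _) (norm_nonneg _)]
  constructor
  · intro h
    have hy : y ∈ C := by
      by_contra hy
      obtain ⟨v, hv⟩ := hne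
      have := h v
      rw [proxObjective_indicatorFn_of_notMem hy, proxObjective_indicatorFn_of_mem hv] at this
      exact EReal.coe_ne_top _ (top_le_iff.mp this)
    exact ⟨hy, fun w hw => (hle hy hw).mp (h w)⟩
  · rintro ⟨hy, h⟩ w
    by_cases hw : w ∈ C
    · exact (hle hy hw).mpr (h w hw)
    · exact (proxObjective_indicatorFn_of_notMem hw x).symm ▸ le_top

theorem norm_eq_iInf_iff_forall_le {C : Set E} {x y : E} (hy : y ∈ C) :
    ‖x - y‖ = ⨅ w : C, ‖x - w‖ ↔ ∀ w ∈ C, ‖x - y‖ ≤ ‖x - w‖ := by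
  have hbdd : BddBelow (Set.range fun w : C => ‖x - w‖) :=
    ⟨0, Set.forall_mem_range.mpr fun _ => norm_nonneg _⟩
  have : Nonempty C := ⟨⟨y, hy⟩⟩
  constructor
  · exact fun h w hw => h ▸ ciInf_le hbdd ⟨w, hw⟩
  · exact fun h => le_antisymm (le_ciInf fun w => h w w.2) (ciInf_le hbdd ⟨y, hy⟩)

variable [InnerProductSpace ℝ E] [CompleteSpace E] {C : Set E} (hne : C.Nonempty)
  (hcl : IsClosed C) (hcv : Convex ℝ C)

include hne hcl hcv

theorem prox_indicatorFn_le (x w : E) :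
    proxObjective (indicatorFn C) x (prox (indicatorFn C) x) ≤
      proxObjective (indicatorFn C) x w := by
  refine Classical.epsilon_spec
    (p := fun y => ∀ w, proxObjective (indicatorFn C) x y ≤ proxObjective (indicatorFn C) x w)
    ?_ w
  obtain ⟨v, hv, hmin⟩ := exists_norm_eq_iInf_of_complete_convex hne hcl.isComplete hcv x
  exact ⟨v, (forall_proxObjective_indicatorFn_le_iff hne).mpr
    ⟨hv, (norm_eq_iInf_iff_forall_le hv).mp hmin⟩⟩

theorem prox_indicatorFn_mem (x : E) : prox (indicatorFn C) x ∈ C :=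
  ((forall_proxObjective_indicatorFn_le_iff hne).mp (prox_indicatorFn_le hne hcl hcv x)).1

theorem norm_sub_prox_indicatorFn_le (x : E) {w : E} (hw : w ∈ C) :
    ‖x - prox (indicatorFn C) x‖ ≤ ‖x - w‖ :=
  ((forall_proxObjective_indicatorFn_le_iff hne).mp (prox_indicatorFn_le hne hcl hcv x)).2 w hw

theorem inner_sub_prox_indicatorFn_le (x : E) {w : E} (hw : w ∈ C) :
    ⟪x - prox (indicatorFn C) x, w - prox (indicatorFn C) x⟫_ℝ ≤ 0 := by
  have hmem := prox_indicatorFn_mem hne hcl hcv x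
  exact (norm_eq_iInf_iff_real_inner_le_zero hcv hmem).mp ((norm_eq_iInf_iff_forall_le hmem).mpr
    fun _ => norm_sub_prox_indicatorFn_le hne hcl hcv x) w hw

theorem prox_indicatorFn_eq_of_forall_inner_le {x y : E} (hy : y ∈ C)
    (hvar : ∀ w ∈ C, ⟪x - y, w - y⟫_ℝ ≤ 0) : prox (indicatorFn C) x = y := by
  have h₁ := inner_sub_prox_indicatorFn_le hne hcl hcv x hy
  have h₂ := hvar _ (prox_indicatorFn_mem hne hcl hcv x)
  set p := prox (indicatorFn C) x
  have h₃ : ‖p - y‖ ^ 2 = ⟪x - y, p - y⟫_ℝ + ⟪x - p, y - p⟫_ℝ := by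
    rw [← neg_sub p y, inner_neg_right, ← sub_eq_add_neg, ← inner_sub_left,
      sub_sub_sub_cancel_left, real_inner_self_eq_norm_sq]
  rw [← sub_eq_zero, ← norm_eq_zero, ← sq_eq_zero_iff]
  exact le_antisymm (by linarith) (sq_nonneg _)

theorem firmlyNonexpansive_prox_indicatorFn : FirmlyNonexpansive (prox (indicatorFn C)) := by
  intro x y
  have hx := inner_sub_prox_indicatorFn_le hne hcl hcv x (prox_indicatorFn_mem hne hcl hcv y)
  have hy := inner_sub_prox_indicatorFn_le hne hcl hcv y (prox_indicatorFn_mem hne hcl hcv x)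
  set p := prox (indicatorFn C) x
  set q := prox (indicatorFn C) y
  have key : ⟪p - q, x - y⟫_ℝ - ‖p - q‖ ^ 2 = -⟪x - p, q - p⟫_ℝ - ⟪y - q, p - q⟫_ℝ := by
    rw [← neg_sub p q, inner_neg_right, neg_neg, ← inner_sub_left, ← real_inner_self_eq_norm_sq,
      ← inner_sub_right, real_inner_comm]
    congr 1
    abel
  linarith

theorem moreauEnvelope_indicatorFn (x : E) :
    moreauEnvelope (indicatorFn C) x = 1 / 2 * ‖x - prox (indicatorFn C) x‖ ^ 2 := by
  have h : ⨅ y, proxObjective (indicatorFn C) x y =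
      proxObjective (indicatorFn C) x (prox (indicatorFn C) x) :=
    le_antisymm (iInf_le _ _) (le_iInf (prox_indicatorFn_le hne hcl hcv x))
  rw [moreauEnvelope, h, proxObjective_indicatorFn_of_mem (prox_indicatorFn_mem hne hcl hcv x),
    EReal.toReal_coe]

theorem moreauEnvelope_indicatorFn_le (x y : E) :
    moreauEnvelope (indicatorFn C) y ≤ moreauEnvelope (indicatorFn C) x +
      ⟪x - prox (indicatorFn C) x, y - x⟫_ℝ + 1 / 2 * ‖y - x‖ ^ 2 := by
  have hle := norm_sub_prox_indicatorFn_le hne hcl hcv y (prox_indicatorFn_mem hne hcl hcv x)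
  rw [moreauEnvelope_indicatorFn hne hcl hcv, moreauEnvelope_indicatorFn hne hcl hcv]
  calc 1 / 2 * ‖y - prox (indicatorFn C) y‖ ^ 2
      ≤ 1 / 2 * ‖(x - prox (indicatorFn C) x) + (y - x)‖ ^ 2 := by
        rw [add_comm, sub_add_sub_cancel]
        gcongr
    _ = _ := by rw [norm_add_sq_real]; ring

theorem hasGradientAt_moreauEnvelope_indicatorFn (x : E) :
    HasGradientAt (moreauEnvelope (indicatorFn C)) (x - prox (indicatorFn C) x) x := by
  rw [hasGradientAt_iff_isLittleO]
  refine IsBigO.trans_isLittleO (.of_bound (1 / 2) (.of_forall fun y => ?_))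
    ((isLittleO_norm_pow_id one_lt_two).comp_tendsto (tendsto_sub_nhds_zero_iff.mpr tendsto_id))
  have hxy := moreauEnvelope_indicatorFn_le hne hcl hcv x y
  have hyx := moreauEnvelope_indicatorFn_le hne hcl hcv y x
  have hmono := (sq_nonneg _).trans
    ((firmlyNonexpansive_prox_indicatorFn hne hcl hcv).id_sub y x)
  rw [← neg_sub y x, inner_neg_right, norm_neg] at hyx
  rw [inner_sub_left] at hmono
  rw [Real.norm_eq_abs, abs_le]
  simp only [Function.comp_apply, norm_pow, norm_norm]
  constructor <;> linarith

end Projection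

section GradientCalculus

variable {E G : Type*} [NormedAddCommGroup E] [InnerProductSpace ℝ E] [CompleteSpace E]
  [NormedAddCommGroup G] [InnerProductSpace ℝ G] [CompleteSpace G]

theorem hasGradientAt_add {f g : E → ℝ} {a b x : E} (hf : HasGradientAt f a x)
    (hg : HasGradientAt g b x) : HasGradientAt (fun y => f y + g y) (a + b) x := by
  rw [hasGradientAt_iff_hasFDerivAt, map_add]
  exact hf.hasFDerivAt.add hg.hasFDerivAt

theorem hasGradientAt_const_mul (r : ℝ) {f : E → ℝ} {a x : E} (hf : HasGradientAt f a x) :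
    HasGradientAt (fun y => r * f y) (r • a) x := by
  rw [hasGradientAt_iff_hasFDerivAt, map_smul]
  exact hf.hasFDerivAt.const_mul r

theorem hasGradientAt_sub {f g : E → ℝ} {a b x : E} (hf : HasGradientAt f a x)
    (hg : HasGradientAt g b x) : HasGradientAt (fun y => f y - g y) (a - b) x := by
  rw [hasGradientAt_iff_hasFDerivAt, map_sub]
  exact hf.hasFDerivAt.sub hg.hasFDerivAt

theorem hasGradientAt_comp_sub (T : E →L[ℝ] G) (b : G) {f : G → ℝ} {a : G} {x : E}
    (hf : HasGradientAt f a (T x - b)) :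
    HasGradientAt (fun y => f (T y - b)) (T.adjoint a) x := by
  rw [hasGradientAt_iff_hasFDerivAt]
  refine (hf.hasFDerivAt.comp x (T.hasFDerivAt.sub_const b)).congr_fderiv ?_
  ext v
  simp [ContinuousLinearMap.adjoint_inner_left]

theorem hasGradientAt_half_inner_self {T : E →L[ℝ] E} (hT : IsSelfAdjoint T) (x : E) :
    HasGradientAt (fun y => 1 / 2 * ⟪y, T y⟫_ℝ) (T x) x := by
  rw [hasGradientAt_iff_hasFDerivAt]
  refine (((hasFDerivAt_id x).inner ℝ T.hasFDerivAt).const_mul (1 / 2)).congr_fderiv ?_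
  ext v
  have hsymm : ⟪x, T v⟫_ℝ = ⟪T x, v⟫_ℝ := (hT.isSymmetric x v).symm
  simp [hsymm, real_inner_comm v]
  ring

theorem hasGradientAt_half_norm_sq (x : E) : HasGradientAt (fun y => 1 / 2 * ‖y‖ ^ 2) x x := by
  simpa using hasGradientAt_half_inner_self (IsSelfAdjoint.one (E →L[ℝ] E)) x

theorem inner_hasFDerivAt_gradient_comm {Φ : E → ℝ} {F : E → E}
    (hgrad : ∀ x, HasGradientAt Φ (F x) x) {T : E →L[ℝ] E} {x : E} (hT : HasFDerivAt F T x)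
    (v w : E) : ⟪T v, w⟫_ℝ = ⟪v, T w⟫_ℝ := by
  have h : ⟪T v, w⟫_ℝ = ⟪T w, v⟫_ℝ := second_derivative_symmetric
    (fun y => (hgrad y).hasFDerivAt) ((innerSL ℝ).hasFDerivAt.comp x hT) v w
  rw [h, real_inner_comm]

end GradientCalculus

section ClarkeJacobian

variable {ι : Type*} [Fintype ι] [DecidableEq ι]

theorem clarkeJacobian_subset {F : EuclideanSpace ℝ ι → EuclideanSpace ℝ ι} {s : Set (Matrix ι ι ℝ)}
    (hcl : IsClosed s) (hcv : Convex ℝ s)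
    (h : ∀ y J, HasFDerivAt F (Matrix.toEuclideanCLM (n := ι) (𝕜 := ℝ) J) y → J ∈ s)
    (x : EuclideanSpace ℝ ι) : clarkeJacobian F x ⊆ s := by
  refine convexHull_min ?_ hcv
  rintro V ⟨u, J, -, hJ, hlim⟩
  exact hcl.mem_of_tendsto hlim (.of_forall fun k => h (u k) (J k) (hJ k))

theorem isHermitian_of_mem_clarkeJacobian {Φ : EuclideanSpace ℝ ι → ℝ}
    {F : EuclideanSpace ℝ ι → EuclideanSpace ℝ ι} (hgrad : ∀ x, HasGradientAt Φ (F x) x)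
    {x : EuclideanSpace ℝ ι} {Q : Matrix ι ι ℝ} (hQ : Q ∈ clarkeJacobian F x) : Q.IsHermitian := by
  have hcl : IsClosed {Q : Matrix ι ι ℝ | Q.IsHermitian} :=
    isClosed_eq continuous_id.matrix_conjTranspose continuous_id
  have hcv : Convex ℝ {Q : Matrix ι ι ℝ | Q.IsHermitian} :=
    (selfAdjoint.submodule ℝ (Matrix ι ι ℝ)).convex
  refine clarkeJacobian_subset hcl hcv (fun y J hJ => ?_) x hQ
  exact Matrix.isSymmetric_toEuclideanLin_iff.mp (inner_hasFDerivAt_gradient_comm hgrad hJ)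

theorem setOf_firmlyNonexpansive_eq_iInter :
    {Q : Matrix ι ι ℝ | FirmlyNonexpansive (Matrix.toEuclideanLin Q)} =
      ⋂ v, (LinearMap.applyₗ v ∘ₗ Matrix.toEuclideanLin.toLinearMap) ⁻¹'
        Metric.closedBall ((1 / 2 : ℝ) • v) (1 / 2 * ‖v‖) := by
  ext Q
  rw [Set.mem_ofPred_eq, firmlyNonexpansive_iff_forall_norm_sq_le_inner, Set.mem_iInter]
  exact forall_congr' fun v => norm_sq_le_inner_iff_mem_closedBall

theorem isClosed_setOf_firmlyNonexpansive :
    IsClosed {Q : Matrix ι ι ℝ | FirmlyNonexpansive (Matrix.toEuclideanLin Q)} := by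
  rw [setOf_firmlyNonexpansive_eq_iInter]
  exact isClosed_iInter fun v =>
    Metric.isClosed_closedBall.preimage (LinearMap.continuous_of_finiteDimensional _)

theorem convex_setOf_firmlyNonexpansive :
    Convex ℝ {Q : Matrix ι ι ℝ | FirmlyNonexpansive (Matrix.toEuclideanLin Q)} := by
  rw [setOf_firmlyNonexpansive_eq_iInter]
  exact convex_iInter fun v => (convex_closedBall _ _).linear_preimage _

theorem firmlyNonexpansive_of_mem_clarkeJacobian {F : EuclideanSpace ℝ ι → EuclideanSpace ℝ ι}
    (hF : FirmlyNonexpansive F) {x : EuclideanSpace ℝ ι} {Q : Matrix ι ι ℝ}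
    (hQ : Q ∈ clarkeJacobian F x) : FirmlyNonexpansive (Matrix.toEuclideanLin Q) := by
  refine clarkeJacobian_subset isClosed_setOf_firmlyNonexpansive convex_setOf_firmlyNonexpansive
    (fun y J hJ => ?_) x hQ
  rw [Set.mem_ofPred_eq, ← Matrix.coe_toEuclideanCLM_eq_toEuclideanLin]
  exact hF.of_hasFDerivAt hJ

theorem isHermitian_of_mem_clarkeJacobian_prox_indicatorFn {C : Set (EuclideanSpace ℝ ι)}
    (hne : C.Nonempty) (hcl : IsClosed C) (hcv : Convex ℝ C) {x : EuclideanSpace ℝ ι}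
    {Q : Matrix ι ι ℝ} (hQ : Q ∈ clarkeJacobian (prox (indicatorFn C)) x) : Q.IsHermitian := by
  refine isHermitian_of_mem_clarkeJacobian
    (Φ := fun y => 1 / 2 * ‖y‖ ^ 2 - moreauEnvelope (indicatorFn C) y) (fun y => ?_) hQ
  simpa using hasGradientAt_sub (hasGradientAt_half_norm_sq y)
    (hasGradientAt_moreauEnvelope_indicatorFn hne hcl hcv y)

end ClarkeJacobian

section Orthant

variable {ι : Type*}

theorem orthant_nonempty : (orthant ι).Nonempty := ⟨0, fun _ => le_rfl⟩

theorem isClosed_orthant : IsClosed (orthant ι) := by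
  rw [orthant, Set.ofPred_forall]
  exact isClosed_iInter fun i => isClosed_le continuous_const (by fun_prop)

theorem convex_orthant : Convex ℝ (orthant ι) := by
  intro x hx y hy a b ha hb _ i
  exact add_nonneg (mul_nonneg ha (hx i)) (mul_nonneg hb (hy i))

theorem isHermitian_of_mem_jacobianOrthant [DecidableEq ι] {η : EuclideanSpace ℝ ι}
    {P : Matrix ι ι ℝ} (hP : P ∈ jacobianOrthant η) : P.IsHermitian := by
  obtain ⟨q, rfl, -⟩ := hP
  exact Matrix.isHermitian_diagonal q

variable [Fintype ι]

theorem firmlyNonexpansive_prox_orthant :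
    FirmlyNonexpansive (prox (indicatorFn (orthant ι))) :=
  firmlyNonexpansive_prox_indicatorFn orthant_nonempty isClosed_orthant convex_orthant

theorem prox_orthant (η : EuclideanSpace ℝ ι) :
    prox (indicatorFn (orthant ι)) η = WithLp.toLp 2 fun i => max (η i) 0 := by
  refine prox_indicatorFn_eq_of_forall_inner_le orthant_nonempty isClosed_orthant convex_orthant
    (fun i => le_max_right _ _) fun w hw => ?_
  rw [PiLp.inner_apply]
  refine Finset.sum_nonpos fun i _ => ?_
  simp only [PiLp.sub_apply, RCLike.inner_apply, conj_trivial]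
  have hwi := hw i
  rcases le_total (η i) 0 with h | h
  · rw [max_eq_right h, sub_zero, sub_zero]
    exact mul_nonpos_of_nonneg_of_nonpos hwi h
  · simp [h]

theorem exists_tendsto_inv_smul_max_sub (a b : ℝ) :
    ∃ d, Tendsto (fun t : ℝ => t⁻¹ • (max (a + t * b) 0 - max a 0)) (𝓝[>] 0) (𝓝 d) := by
  have hconv : ConvexOn ℝ Set.univ fun t : ℝ => max (a + t * b) 0 :=
    ((convexOn_const a convex_univ).add ((LinearMap.mulRight ℝ b).convexOn convex_univ)).sup
      (convexOn_const 0 convex_univ)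
  have hderiv := hconv.hasDerivWithinAt_rightDeriv_of_mem_interior (x := 0) (by simp)
  rw [hasDerivWithinAt_iff_tendsto_slope' (by simp)] at hderiv
  exact ⟨_, hderiv.congr fun t => by simp [slope]⟩

theorem exists_tendsto_inv_smul_prox_orthant_sub (η h : EuclideanSpace ℝ ι) :
    ∃ d, Tendsto (fun t : ℝ => t⁻¹ • (prox (indicatorFn (orthant ι)) (η + t • h) -
      prox (indicatorFn (orthant ι)) η)) (𝓝[>] 0) (𝓝 d) := by
  choose d hd using fun i => exists_tendsto_inv_smul_max_sub (η i) (h i)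
  refine ⟨WithLp.toLp 2 d, ?_⟩
  simp only [prox_orthant]
  exact ((PiLp.continuous_toLp 2 _).tendsto _).comp (tendsto_pi_nhds.mpr hd)

theorem eventually_max_sub_eq_mul (a : ℝ) : ∀ᶠ h in 𝓝 0, ∀ q : ℝ,
    (a + h < 0 → q = 0) → (0 < a + h → q = 1) → max (a + h) 0 - max a 0 = q * h := by
  have hlim : Tendsto (fun h => a + h) (𝓝 0) (𝓝 a) := by
    simpa using (continuous_const_add a).tendsto 0
  rcases lt_trichotomy a 0 with ha | rfl | ha
  · filter_upwards [hlim.eventually_lt_const ha] with h hh q hneg _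
    simp [hneg hh, hh.le, ha.le]
  · refine .of_forall fun h q hneg hpos => ?_
    rw [zero_add] at *
    rcases lt_trichotomy h 0 with hh | rfl | hh
    · simp [hneg hh, hh.le]
    · simp
    · simp [hpos hh, hh.le]
  · filter_upwards [hlim.eventually_const_lt ha] with h hh q _ hpos
    simp [hpos hh, hh.le, ha.le]

variable [DecidableEq ι]

theorem eventually_prox_orthant_sub_eq (η : EuclideanSpace ℝ ι) :
    ∀ᶠ h in 𝓝 0, ∀ P ∈ jacobianOrthant (η + h),
      prox (indicatorFn (orthant ι)) (η + h) - prox (indicatorFn (orthant ι)) η =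
        Matrix.toEuclideanLin P h := by
  have hcoord : ∀ᶠ h : EuclideanSpace ℝ ι in 𝓝 0, ∀ i (q : ℝ), (η i + h i < 0 → q = 0) →
      (0 < η i + h i → q = 1) → max (η i + h i) 0 - max (η i) 0 = q * h i :=
    eventually_all.mpr fun i =>
      ((EuclideanSpace.proj (𝕜 := ℝ) i).continuous.tendsto' 0 0 (by simp)).eventually
        (eventually_max_sub_eq_mul (η i))
  filter_upwards [hcoord] with h hh P hP
  obtain ⟨q, rfl, hq⟩ := hP
  ext i
  simpa [prox_orthant, Matrix.toLpLin_apply, Matrix.mulVec_diagonal] using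
    hh i (q i) (hq i).1 (hq i).2.2

theorem firmlyNonexpansive_of_mem_jacobianOrthant {η : EuclideanSpace ℝ ι} {P : Matrix ι ι ℝ}
    (hP : P ∈ jacobianOrthant η) : FirmlyNonexpansive (Matrix.toEuclideanLin P) := by
  obtain ⟨q, rfl, hq⟩ := hP
  have hq01 (i : ι) : q i ∈ Set.Icc (0 : ℝ) 1 := by
    obtain ⟨hneg, hzero, hpos⟩ := hq i
    rcases lt_trichotomy (η i) 0 with h | h | h
    · simp [hneg h]
    · exact hzero h
    · simp [hpos h]
  refine firmlyNonexpansive_iff_forall_norm_sq_le_inner.mpr fun v => ?_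
  rw [EuclideanSpace.real_norm_sq_eq, PiLp.inner_apply]
  refine Finset.sum_le_sum fun i _ => ?_
  simp only [Matrix.toLpLin_apply, Matrix.mulVec_diagonal, RCLike.inner_apply, conj_trivial]
  calc (q i * v i) ^ 2 = q i ^ 2 * v i ^ 2 := mul_pow _ _ _
    _ ≤ q i * v i ^ 2 := by
      gcongr
      exact pow_le_of_le_one (hq01 i).1 (hq01 i).2 two_ne_zero
    _ = v i * (q i * v i) := by ring

end Orthant

section QuadraticForms

variable {ι : Type*} [Fintype ι] [DecidableEq ι] {H : Matrix ι ι ℝ}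

theorem normSqH_nonneg (hH : H.PosSemidef) (v : EuclideanSpace ℝ ι) : 0 ≤ normSqH H v :=
  (Matrix.isPositive_toEuclideanLin_iff.mpr hH).inner_nonneg_right v

theorem exists_mul_norm_sq_le_normSqH (hH : H.PosDef) :
    ∃ c > 0, ∀ v, c * ‖v‖ ^ 2 ≤ normSqH H v := by
  have hcont : Continuous (normSqH H) :=
    continuous_id.inner (LinearMap.continuous_of_finiteDimensional _)
  obtain ⟨c, hc, hle⟩ := (isCompact_sphere (0 : EuclideanSpace ℝ ι) 1).exists_forall_le'
    hcont.continuousOn (a := 0) fun v hv =>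
      inner_toEuclideanLin_self_pos hH (ne_zero_of_mem_unit_sphere ⟨v, hv⟩)
  refine ⟨c, hc, fun v => ?_⟩
  rcases eq_or_ne v 0 with rfl | hv
  · simp [normSqH]
  · have hunit := hle (‖v‖⁻¹ • v) (by simp [norm_smul, hv])
    rw [normSqH, map_smul, real_inner_smul_left, real_inner_smul_right] at hunit
    calc c * ‖v‖ ^ 2 ≤ ‖v‖⁻¹ * (‖v‖⁻¹ * ⟪v, Matrix.toEuclideanLin H v⟫_ℝ) * ‖v‖ ^ 2 := by gcongr
      _ = normSqH H v := by
        rw [normSqH]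
        field

theorem posDef_of_mul_norm_sq_le_inner (hH : H.IsHermitian) {c : ℝ} (hc : 0 < c)
    (h : ∀ v, c * ‖v‖ ^ 2 ≤ ⟪Matrix.toEuclideanLin H v, v⟫_ℝ) : H.PosDef := by
  refine .of_dotProduct_mulVec_pos hH fun x hx => ?_
  have hpos : 0 < c * ‖WithLp.toLp 2 x‖ ^ 2 := by
    have : 0 < ‖WithLp.toLp 2 x‖ := by simpa using hx
    positivity
  simpa [EuclideanSpace.inner_eq_star_dotProduct, Matrix.toLpLin_apply] using hpos.trans_le (h _)

theorem hasGradientAt_half_normSqH (hH : H.IsHermitian) (x : EuclideanSpace ℝ ι) :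
    HasGradientAt (fun y => 1 / 2 * normSqH H y) (Matrix.toEuclideanLin H x) x :=
  hasGradientAt_half_inner_self (T := Matrix.toEuclideanCLM (n := ι) (𝕜 := ℝ) H)
    (hH.isSelfAdjoint.map _) x

end QuadraticForms

section BlockSet

variable {n d : ℕ} {D : Set (EuclideanSpace ℝ (Fin d))}

/-- The product set `𝒟ⁿ ⊆ ℝ^{dn}`, whose indicator function is the penalty `p`. -/
def blockSet (n : ℕ) (D : Set (EuclideanSpace ℝ (Fin d))) :
    Set (EuclideanSpace ℝ (Fin n × Fin d)) :=
  {ξ | ∀ i, block ξ i ∈ D}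

theorem penalty_eq_indicatorFn : penalty n D = indicatorFn (blockSet n D) := by
  funext ξ
  by_cases h : ξ ∈ blockSet n D
  · rw [indicatorFn, if_pos h]
    exact Finset.sum_eq_zero fun i _ => if_pos (h i)
  · obtain ⟨i, hi⟩ : ∃ i, block ξ i ∉ D := by simpa [blockSet] using h
    have hnonneg (j : Fin n) : 0 ≤ indicatorFn D (block ξ j) := by
      rw [indicatorFn]
      split_ifs <;> simp
    have hle := Finset.single_le_sum (fun j _ => hnonneg j) (Finset.mem_univ i)
    rw [indicatorFn, if_neg hi, top_le_iff] at hle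
    rw [penalty, hle, indicatorFn, if_neg h]

theorem blockSet_nonempty (hD : D.Nonempty) : (blockSet n D).Nonempty :=
  hD.imp' (fun x => WithLp.toLp 2 fun q => x q.2) fun _ hx _ => hx

theorem isClosed_blockSet (hD : IsClosed D) : IsClosed (blockSet n D) := by
  rw [blockSet, Set.ofPred_forall]
  refine isClosed_iInter fun i => hD.preimage (f := fun ξ => block ξ i) ?_
  unfold block
  fun_prop

theorem convex_blockSet (hD : Convex ℝ D) : Convex ℝ (blockSet n D) :=
  fun _ hx _ hy _ _ ha hb hab i => hD (hx i) (hy i) ha hb hab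

end BlockSet

namespace Subproblem

variable {n d : ℕ} {S : Subproblem n d}

section Penalty

variable (hne : S.D.Nonempty) (hcl : IsClosed S.D) (hcv : Convex ℝ S.D)

include hne hcl hcv

theorem firmlyNonexpansive_prox_p : FirmlyNonexpansive (prox S.p) := by
  rw [p, penalty_eq_indicatorFn]
  exact firmlyNonexpansive_prox_indicatorFn (blockSet_nonempty hne) (isClosed_blockSet hcl)
    (convex_blockSet hcv)

theorem hasGradientAt_moreauEnvelope_p (x : EuclideanSpace ℝ (Fin n × Fin d)) :
    HasGradientAt (moreauEnvelope S.p) (x - prox S.p x) x := by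
  rw [p, penalty_eq_indicatorFn]
  exact hasGradientAt_moreauEnvelope_indicatorFn (blockSet_nonempty hne) (isClosed_blockSet hcl)
    (convex_blockSet hcv) x

theorem isHermitian_of_mem_clarkeJacobian_prox_p {x : EuclideanSpace ℝ (Fin n × Fin d)}
    {Q : Matrix (Fin n × Fin d) (Fin n × Fin d) ℝ} (hQ : Q ∈ clarkeJacobian (prox S.p) x) :
    Q.IsHermitian := by
  rw [p, penalty_eq_indicatorFn] at hQ
  exact isHermitian_of_mem_clarkeJacobian_prox_indicatorFn (blockSet_nonempty hne)
    (isClosed_blockSet hcl) (convex_blockSet hcv) hQ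

end Penalty

end Subproblem

section Coordinates

/-- `thetaPart` as a continuous linear map. -/
noncomputable def thetaMap (n d : ℕ) : Var n d →L[ℝ] EuclideanSpace ℝ (Fin n) :=
  LinearMap.toContinuousLinearMap
    { toFun := thetaPart, map_add' := fun _ _ => rfl, map_smul' := fun _ _ => rfl }

/-- `xiPart` as a continuous linear map. -/
noncomputable def xiMap (n d : ℕ) : Var n d →L[ℝ] EuclideanSpace ℝ (Fin n × Fin d) :=
  LinearMap.toContinuousLinearMap
    { toFun := xiPart, map_add' := fun _ _ => rfl, map_smul' := fun _ _ => rfl }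

variable {n d : ℕ}

theorem thetaMap_apply (z : Var n d) : thetaMap n d z = thetaPart z := rfl

theorem xiMap_apply (z : Var n d) : xiMap n d z = xiPart z := rfl

theorem inner_eq_inner_thetaMap_add_inner_xiMap (v w : Var n d) :
    ⟪v, w⟫_ℝ = ⟪thetaMap n d v, thetaMap n d w⟫_ℝ + ⟪xiMap n d v, xiMap n d w⟫_ℝ := by
  simp only [PiLp.inner_apply, Fintype.sum_sum_type]
  rfl

theorem norm_sq_eq_norm_sq_thetaMap_add_norm_sq_xiMap (v : Var n d) :
    ‖v‖ ^ 2 = ‖thetaMap n d v‖ ^ 2 + ‖xiMap n d v‖ ^ 2 := by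
  simp only [← real_inner_self_eq_norm_sq, inner_eq_inner_thetaMap_add_inner_xiMap v v]

theorem toEuclideanLin_fromBlocks_zero_zero (M : Matrix (Fin n) (Fin n) ℝ)
    (N : Matrix (Fin n × Fin d) (Fin n × Fin d) ℝ) (v : Var n d) :
    Matrix.toEuclideanLin (Matrix.fromBlocks M 0 0 N) v =
      (thetaMap n d).adjoint (Matrix.toEuclideanLin M (thetaMap n d v)) +
        (xiMap n d).adjoint (Matrix.toEuclideanLin N (xiMap n d v)) := by
  refine ext_inner_right ℝ fun w => ?_
  rw [inner_add_left, ContinuousLinearMap.adjoint_inner_left,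
    ContinuousLinearMap.adjoint_inner_left, inner_eq_inner_thetaMap_add_inner_xiMap]
  simp only [Matrix.toLpLin_apply, Matrix.fromBlocks_mulVec, Matrix.zero_mulVec, add_zero, zero_add]
  rfl

end Coordinates

theorem toEuclideanLin_transpose_mul_mul {ι κ : Type*} [Fintype ι] [DecidableEq ι] [Fintype κ]
    [DecidableEq κ] (M : Matrix κ ι ℝ) (N : Matrix κ κ ℝ) (v : EuclideanSpace ℝ ι) :
    Matrix.toEuclideanLin (M.transpose * N * M) v =
      (LinearMap.toContinuousLinearMap (Matrix.toEuclideanLin M)).adjoint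
        (Matrix.toEuclideanLin N (Matrix.toEuclideanLin M v)) := by
  have hadj : (Matrix.toEuclideanLin M).adjoint = Matrix.toEuclideanLin M.transpose := by
    rw [← Matrix.conjTranspose_eq_transpose_of_trivial,
      Matrix.toEuclideanLin_conjTranspose_eq_adjoint]
  rw [← LinearMap.adjoint_toContinuousLinearMap, hadj]
  simp [Matrix.toLpLin_apply, Matrix.mul_assoc]

namespace Subproblem

variable {n d : ℕ} (S : Subproblem n d)

/-- The linear map with matrix `(A B)`. -/
noncomputable def constraintMap : Var n d →L[ℝ] EuclideanSpace ℝ (Fin n × Fin n) :=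
  LinearMap.toContinuousLinearMap (Matrix.toEuclideanLin (Matrix.fromCols (matA n) (matB S.X)))

theorem slack_eq (z : Var n d) :
    S.slack (thetaPart z) (xiPart z) S.ut = S.constraintMap z - S.σ⁻¹ • S.ut := by
  rw [slack, sub_left_inj]
  ext i
  exact (congrFun (Matrix.fromCols_mulVec (matA n) (matB S.X) z.ofLp) i).symm

/-- The map `(v, a, b) ↦ Diag(I + H₁ / σ, H₂ / σ) v + σ (0, a) + σ (A B)ᵀ b`. Up to a constant, the
gradient of `Φ` is its composition with the residuals `id - Prox` of the two envelopes, and the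
elements of `∂̂²Φ` are its compositions with generalized derivatives of those residuals. -/
noncomputable def hessianMap :
    Var n d × EuclideanSpace ℝ (Fin n × Fin d) × EuclideanSpace ℝ (Fin n × Fin n) →L[ℝ] Var n d :=
  let fst := ContinuousLinearMap.fst ℝ (Var n d)
    (EuclideanSpace ℝ (Fin n × Fin d) × EuclideanSpace ℝ (Fin n × Fin n))
  let snd := ContinuousLinearMap.snd ℝ (Var n d)
    (EuclideanSpace ℝ (Fin n × Fin d) × EuclideanSpace ℝ (Fin n × Fin n))
  let H₁ := Matrix.toEuclideanCLM (n := Fin n) (𝕜 := ℝ) S.H₁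
  let H₂ := Matrix.toEuclideanCLM (n := Fin n × Fin d) (𝕜 := ℝ) S.H₂
  (thetaMap n d).adjoint ∘L (1 + S.σ⁻¹ • H₁) ∘L thetaMap n d ∘L fst +
    (xiMap n d).adjoint ∘L (S.σ • ContinuousLinearMap.fst ℝ _ _ ∘L snd +
      S.σ⁻¹ • H₂ ∘L xiMap n d ∘L fst) +
    S.constraintMap.adjoint ∘L (S.σ • ContinuousLinearMap.snd ℝ _ _ ∘L snd)

theorem hessianMap_apply (v : Var n d) (a : EuclideanSpace ℝ (Fin n × Fin d))
    (b : EuclideanSpace ℝ (Fin n × Fin n)) : S.hessianMap (v, a, b) =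
      (thetaMap n d).adjoint
          (thetaMap n d v + S.σ⁻¹ • Matrix.toEuclideanLin S.H₁ (thetaMap n d v)) +
        (xiMap n d).adjoint (S.σ • a + S.σ⁻¹ • Matrix.toEuclideanLin S.H₂ (xiMap n d v)) +
        S.constraintMap.adjoint (S.σ • b) :=
  rfl

theorem inner_hessianMap_self (v : Var n d) (a : EuclideanSpace ℝ (Fin n × Fin d))
    (b : EuclideanSpace ℝ (Fin n × Fin n)) : ⟪S.hessianMap (v, a, b), v⟫_ℝ =
      ‖thetaMap n d v‖ ^ 2 + S.σ⁻¹ * normSqH S.H₁ (thetaMap n d v) + S.σ * ⟪a, xiMap n d v⟫_ℝ +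
        S.σ⁻¹ * normSqH S.H₂ (xiMap n d v) + S.σ * ⟪b, S.constraintMap v⟫_ℝ := by
  simp only [hessianMap_apply, inner_add_left, ContinuousLinearMap.adjoint_inner_left,
    real_inner_smul_left, real_inner_self_eq_norm_sq, normSqH,
    real_inner_comm (Matrix.toEuclideanLin _ _)]
  ring

variable {S}

theorem exists_mul_norm_sq_le_inner_hessianMap (hσ : 0 < S.σ) (hH₁ : S.H₁.PosSemidef)
    (hH₂ : S.H₂.PosDef) : ∃ c > 0, ∀ v a b, ‖a‖ ^ 2 ≤ ⟪a, xiMap n d v⟫_ℝ →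
      ‖b‖ ^ 2 ≤ ⟪b, S.constraintMap v⟫_ℝ → c * ‖v‖ ^ 2 ≤ ⟪S.hessianMap (v, a, b), v⟫_ℝ := by
  obtain ⟨c, hc, hle⟩ := exists_mul_norm_sq_le_normSqH hH₂
  refine ⟨min 1 (S.σ⁻¹ * c), by positivity, fun v a b ha hb => ?_⟩
  have hθ : min 1 (S.σ⁻¹ * c) * ‖thetaMap n d v‖ ^ 2 ≤
      ‖thetaMap n d v‖ ^ 2 + S.σ⁻¹ * normSqH S.H₁ (thetaMap n d v) :=
    (mul_le_of_le_one_left (by positivity) (min_le_left _ _)).trans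
      (le_add_of_nonneg_right (mul_nonneg (by positivity) (normSqH_nonneg hH₁ _)))
  have hξ : min 1 (S.σ⁻¹ * c) * ‖xiMap n d v‖ ^ 2 ≤ S.σ⁻¹ * normSqH S.H₂ (xiMap n d v) :=
    calc min 1 (S.σ⁻¹ * c) * ‖xiMap n d v‖ ^ 2 ≤ S.σ⁻¹ * c * ‖xiMap n d v‖ ^ 2 := by
          gcongr
          exact min_le_right _ _
      _ ≤ S.σ⁻¹ * normSqH S.H₂ (xiMap n d v) := by
          rw [mul_assoc]
          gcongr
          exact hle _
  have ha' : 0 ≤ S.σ * ⟪a, xiMap n d v⟫_ℝ := mul_nonneg hσ.le ((sq_nonneg _).trans ha)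
  have hb' : 0 ≤ S.σ * ⟪b, S.constraintMap v⟫_ℝ := mul_nonneg hσ.le ((sq_nonneg _).trans hb)
  rw [inner_hessianMap_self, norm_sq_eq_norm_sq_thetaMap_add_norm_sq_xiMap, mul_add]
  linarith

variable (S) in
theorem exists_norm_hessianMap_le : ∃ L : ℝ≥0, 0 < L ∧ ∀ v a b, ‖a‖ ^ 2 ≤ ⟪a, xiMap n d v⟫_ℝ →
    ‖b‖ ^ 2 ≤ ⟪b, S.constraintMap v⟫_ℝ → ‖S.hessianMap (v, a, b)‖ ≤ L * ‖v‖ := by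
  refine ⟨‖S.hessianMap‖₊ * (1 + ‖xiMap n d‖₊ + ‖S.constraintMap‖₊) + 1, by positivity,
    fun v a b ha hb => ?_⟩
  have ha' : ‖a‖ ≤ ‖xiMap n d‖ * ‖v‖ := by
    simpa using (mul_norm_le_of_mul_norm_sq_le_inner (c := 1) (v := a) (w := xiMap n d v)
      (by rwa [one_mul, real_inner_comm])).trans ((xiMap n d).le_opNorm v)
  have hb' : ‖b‖ ≤ ‖S.constraintMap‖ * ‖v‖ := by
    simpa using (mul_norm_le_of_mul_norm_sq_le_inner (c := 1) (v := b) (w := S.constraintMap v)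
      (by rwa [one_mul, real_inner_comm])).trans (S.constraintMap.le_opNorm v)
  have hmax : ‖(v, a, b)‖ ≤ (1 + ‖xiMap n d‖ + ‖S.constraintMap‖) * ‖v‖ := by
    have h₁ : 0 ≤ ‖xiMap n d‖ * ‖v‖ := by positivity
    have h₂ : 0 ≤ ‖S.constraintMap‖ * ‖v‖ := by positivity
    simp only [norm_prod_le_iff]
    refine ⟨?_, ?_, ?_⟩ <;> linarith [norm_nonneg v]
  push_cast
  calc ‖S.hessianMap (v, a, b)‖ ≤ ‖S.hessianMap‖ * ‖(v, a, b)‖ := S.hessianMap.le_opNorm _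
    _ ≤ ‖S.hessianMap‖ * ((1 + ‖xiMap n d‖ + ‖S.constraintMap‖) * ‖v‖) := by gcongr
    _ ≤ (‖S.hessianMap‖ * (1 + ‖xiMap n d‖ + ‖S.constraintMap‖) + 1) * ‖v‖ := by
      linarith [norm_nonneg v]

variable (S)

/-- The residual `x - Prox_p(x)` at `x = ξ - ṽ / σ`. -/
noncomputable def xiResidual (z : Var n d) : EuclideanSpace ℝ (Fin n × Fin d) :=
  (xiMap n d z - S.σ⁻¹ • S.vt) - prox S.p (xiMap n d z - S.σ⁻¹ • S.vt)

/-- The residual `η - Π₊(η)` at the slack `η = A θ + B ξ - ũ / σ`. -/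
noncomputable def slackResidual (z : Var n d) : EuclideanSpace ℝ (Fin n × Fin n) :=
  (S.constraintMap z - S.σ⁻¹ • S.ut) -
    prox (indicatorFn (orthant (Fin n × Fin n))) (S.constraintMap z - S.σ⁻¹ • S.ut)

/-- The gradient of `S.Phi`. -/
noncomputable def gradPhi (z : Var n d) : Var n d :=
  S.hessianMap (z, S.xiResidual z, S.slackResidual z) -
    ((thetaMap n d).adjoint (S.Y + S.σ⁻¹ • Matrix.toEuclideanLin S.H₁ S.θt) +
      (xiMap n d).adjoint (S.σ⁻¹ • Matrix.toEuclideanLin S.H₂ S.ξt))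

theorem gradPhi_sub (y z : Var n d) : S.gradPhi y - S.gradPhi z =
    S.hessianMap (y - z, S.xiResidual y - S.xiResidual z,
      S.slackResidual y - S.slackResidual z) := by
  rw [gradPhi, gradPhi, sub_sub_sub_cancel_right, ← map_sub, Prod.mk_sub_mk, Prod.mk_sub_mk]

/-- The generalized Hessian `∂̂²Φ(θ, ξ)` as a set of linear maps. -/
def genHessianMaps (z : Var n d) : Set (Var n d →ₗ[ℝ] Var n d) :=
  Matrix.toEuclideanLin '' S.genHessian z

theorem exists_eq_hessianMap_of_mem_genHessianMaps {z : Var n d} {T : Var n d →ₗ[ℝ] Var n d}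
    (hT : T ∈ S.genHessianMaps z) :
    ∃ P ∈ jacobianOrthant (S.constraintMap z - S.σ⁻¹ • S.ut),
      ∃ Q ∈ clarkeJacobian (prox S.p) (xiMap n d z - S.σ⁻¹ • S.vt), ∀ v, T v =
        S.hessianMap (v, xiMap n d v - Matrix.toEuclideanLin Q (xiMap n d v),
          S.constraintMap v - Matrix.toEuclideanLin P (S.constraintMap v)) := by
  obtain ⟨H, ⟨P, hP, Q, hQ, rfl⟩, rfl⟩ := hT
  rw [slack_eq] at hP
  refine ⟨P, hP, Q, hQ, fun v => ?_⟩
  rw [map_add, LinearMap.add_apply, map_smul, LinearMap.smul_apply,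
    toEuclideanLin_transpose_mul_mul, toEuclideanLin_fromBlocks_zero_zero, hessianMap_apply]
  simp only [map_add, map_sub, map_smul, LinearMap.add_apply, LinearMap.sub_apply,
    LinearMap.smul_apply, Matrix.toLpLin_one, LinearMap.id_apply, constraintMap,
    LinearMap.coe_toContinuousLinearMap']
  abel

variable {S}

theorem norm_sq_slackResidual_sub_le (y z : Var n d) :
    ‖S.slackResidual y - S.slackResidual z‖ ^ 2 ≤
      ⟪S.slackResidual y - S.slackResidual z, S.constraintMap (y - z)⟫_ℝ := by
  simpa [slackResidual] using firmlyNonexpansive_prox_orthant.id_sub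
    (S.constraintMap y - S.σ⁻¹ • S.ut) (S.constraintMap z - S.σ⁻¹ • S.ut)

section Convex

variable (hne : S.D.Nonempty) (hcl : IsClosed S.D) (hcv : Convex ℝ S.D)

include hne hcl hcv

theorem norm_sq_xiResidual_sub_le (y z : Var n d) :
    ‖S.xiResidual y - S.xiResidual z‖ ^ 2 ≤
      ⟪S.xiResidual y - S.xiResidual z, xiMap n d (y - z)⟫_ℝ := by
  simpa [xiResidual] using (firmlyNonexpansive_prox_p hne hcl hcv).id_sub
    (xiMap n d y - S.σ⁻¹ • S.vt) (xiMap n d z - S.σ⁻¹ • S.vt)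

theorem exists_stronglyMonotone_and_lipschitzWith_gradPhi (hσ : 0 < S.σ)
    (hH₁ : S.H₁.PosSemidef) (hH₂ : S.H₂.PosDef) :
    ∃ c > 0, ∃ L : ℝ≥0, 0 < L ∧ StronglyMonotone c S.gradPhi ∧ LipschitzWith L S.gradPhi ∧
      ∀ z, ∀ T ∈ S.genHessianMaps z, ∀ v, c * ‖v‖ ^ 2 ≤ ⟪T v, v⟫_ℝ ∧ ‖T v‖ ≤ L * ‖v‖ := by
  obtain ⟨c, hc, hcoer⟩ := exists_mul_norm_sq_le_inner_hessianMap hσ hH₁ hH₂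
  obtain ⟨L, hL, hbound⟩ := S.exists_norm_hessianMap_le
  refine ⟨c, hc, L, hL, fun y z => ?_, LipschitzWith.of_dist_le_mul fun y z => ?_,
    fun z T hT v => ?_⟩
  · rw [gradPhi_sub]
    exact hcoer _ _ _ (norm_sq_xiResidual_sub_le hne hcl hcv y z)
      (norm_sq_slackResidual_sub_le y z)
  · rw [dist_eq_norm, dist_eq_norm, gradPhi_sub]
    exact hbound _ _ _ (norm_sq_xiResidual_sub_le hne hcl hcv y z)
      (norm_sq_slackResidual_sub_le y z)
  · obtain ⟨P, hP, Q, hQ, hTv⟩ := S.exists_eq_hessianMap_of_mem_genHessianMaps hT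
    have hξ := (firmlyNonexpansive_of_mem_clarkeJacobian (firmlyNonexpansive_prox_p hne hcl hcv)
      hQ).norm_sq_sub_map_le (xiMap n d v)
    have hη := (firmlyNonexpansive_of_mem_jacobianOrthant hP).norm_sq_sub_map_le
      (S.constraintMap v)
    rw [hTv]
    exact ⟨hcoer _ _ _ hξ hη, hbound _ _ _ hξ hη⟩

theorem isHermitian_of_mem_genHessian (hH₁ : S.H₁.IsHermitian) (hH₂ : S.H₂.IsHermitian)
    {z : Var n d} {H : Matrix (Fin n ⊕ Fin n × Fin d) (Fin n ⊕ Fin n × Fin d) ℝ}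
    (hH : H ∈ S.genHessian z) : H.IsHermitian := by
  obtain ⟨P, hP, Q, hQ, rfl⟩ := hH
  have hP' := isHermitian_of_mem_jacobianOrthant hP
  have hQ' := isHermitian_of_mem_clarkeJacobian_prox_p hne hcl hcv hQ
  refine .add ?_ (.fromBlocks ?_ (by simp) ?_)
  · exact (Matrix.isHermitian_conjTranspose_mul_mul _
      (Matrix.isHermitian_one.sub hP')).smul (.all _)
  · exact Matrix.isHermitian_one.add (hH₁.smul (.all _))
  · exact ((Matrix.isHermitian_one.sub hQ').smul (.all _)).add (hH₂.smul (.all _))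

theorem hasGradientAt_Phi (hH₁ : S.H₁.IsHermitian) (hH₂ : S.H₂.IsHermitian) (z : Var n d) :
    HasGradientAt S.Phi (S.gradPhi z) z := by
  have hPhi : S.Phi = fun z => 1 / 2 * ‖thetaMap n d z - S.Y‖ ^ 2
      + S.σ * moreauEnvelope S.p (xiMap n d z - S.σ⁻¹ • S.vt)
      + S.σ * moreauEnvelope (indicatorFn (orthant (Fin n × Fin n)))
          (S.constraintMap z - S.σ⁻¹ • S.ut)
      + S.σ⁻¹ * (1 / 2 * normSqH S.H₁ (thetaMap n d z - S.θt))
      + S.σ⁻¹ * (1 / 2 * normSqH S.H₂ (xiMap n d z - S.ξt))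
      - (1 / (2 * S.σ) * ‖S.ut‖ ^ 2 + 1 / (2 * S.σ) * ‖S.vt‖ ^ 2) := by
    funext z
    rw [Phi, augLagrangian, slack_eq]
    simp only [thetaMap_apply, xiMap_apply]
    ring
  have hY := hasGradientAt_comp_sub (thetaMap n d) S.Y (hasGradientAt_half_norm_sq _) (x := z)
  have hξ := hasGradientAt_comp_sub (xiMap n d) (S.σ⁻¹ • S.vt)
    (hasGradientAt_moreauEnvelope_p hne hcl hcv _) (x := z)
  have hη := hasGradientAt_comp_sub S.constraintMap (S.σ⁻¹ • S.ut)
    (hasGradientAt_moreauEnvelope_indicatorFn orthant_nonempty isClosed_orthant convex_orthant _)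
    (x := z)
  have hθt := hasGradientAt_comp_sub (thetaMap n d) S.θt (hasGradientAt_half_normSqH hH₁ _) (x := z)
  have hξt := hasGradientAt_comp_sub (xiMap n d) S.ξt (hasGradientAt_half_normSqH hH₂ _) (x := z)
  rw [hPhi]
  convert hasGradientAt_sub (hasGradientAt_add (hasGradientAt_add (hasGradientAt_add
    (hasGradientAt_add hY (hasGradientAt_const_mul S.σ hξ)) (hasGradientAt_const_mul S.σ hη))
    (hasGradientAt_const_mul S.σ⁻¹ hθt)) (hasGradientAt_const_mul S.σ⁻¹ hξt))
    (hasGradientAt_const z _) using 1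
  simp only [gradPhi, hessianMap_apply, xiResidual, slackResidual, map_add, map_sub, map_smul,
    smul_sub]
  abel

end Convex

theorem exists_tendsto_inv_smul_gradPhi_sub
    (hprox : StronglySemismooth (prox S.p) (clarkeJacobian (prox S.p))) (z h : Var n d) :
    ∃ d, Tendsto (fun t : ℝ => t⁻¹ • (S.gradPhi (z + t • h) - S.gradPhi z)) (𝓝[>] 0) (𝓝 d) := by
  obtain ⟨a, ha⟩ := exists_tendsto_inv_smul_residual_sub
    ((hprox.2 (xiMap n d z - S.σ⁻¹ • S.vt)).1 (xiMap n d h))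
  obtain ⟨b, hb⟩ := exists_tendsto_inv_smul_residual_sub
    (exists_tendsto_inv_smul_prox_orthant_sub (S.constraintMap z - S.σ⁻¹ • S.ut)
      (S.constraintMap h))
  refine ⟨S.hessianMap (h, a, b), ((S.hessianMap.continuous.tendsto _).comp
    (tendsto_const_nhds.prodMk_nhds (ha.prodMk_nhds hb))).congr' ?_⟩
  filter_upwards [self_mem_nhdsWithin] with t ht
  rw [gradPhi_sub, ← map_smul, add_sub_cancel_left, Prod.smul_mk, Prod.smul_mk,
    inv_smul_smul₀ (ne_of_gt ht)]
  rfl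

theorem exists_eventually_norm_xiResidual_sub_sub_le
    (hprox : StronglySemismooth (prox S.p) (clarkeJacobian (prox S.p))) (z : Var n d) :
    ∃ C, ∀ᶠ y in 𝓝 z, ∀ Q ∈ clarkeJacobian (prox S.p) (xiMap n d y - S.σ⁻¹ • S.vt),
      ‖S.xiResidual y - S.xiResidual z -
        (xiMap n d (y - z) - Matrix.toEuclideanLin Q (xiMap n d (y - z)))‖ ≤
          C * ‖y - z‖ ^ 2 := by
  obtain ⟨C, ε, hε, hC⟩ := (hprox.2 (xiMap n d z - S.σ⁻¹ • S.vt)).2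
  have hlim : Tendsto (fun y => xiMap n d (y - z)) (𝓝 z) (𝓝 0) :=
    ((xiMap n d).continuous.comp (continuous_sub_right z)).tendsto' z 0 (by simp)
  refine ⟨|C| * ‖xiMap n d‖ ^ 2, ?_⟩
  filter_upwards [hlim.eventually (Metric.ball_mem_nhds 0 hε)] with y hy Q hQ
  have hadd : xiMap n d z - S.σ⁻¹ • S.vt + xiMap n d (y - z) = xiMap n d y - S.σ⁻¹ • S.vt := by
    rw [map_sub]
    abel
  have hbound := hC (xiMap n d (y - z)) (mem_ball_zero_iff.mp hy) Q (by rwa [hadd])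
  have heq : S.xiResidual y - S.xiResidual z -
      (xiMap n d (y - z) - Matrix.toEuclideanLin Q (xiMap n d (y - z))) =
        -(prox S.p (xiMap n d y - S.σ⁻¹ • S.vt) - prox S.p (xiMap n d z - S.σ⁻¹ • S.vt) -
          Matrix.toEuclideanLin Q (xiMap n d (y - z))) := by
    rw [xiResidual, xiResidual, ← hadd]
    abel
  rw [hadd] at hbound
  rw [heq, norm_neg]
  calc _ ≤ C * ‖xiMap n d (y - z)‖ ^ 2 := hbound
    _ ≤ |C| * (‖xiMap n d‖ * ‖y - z‖) ^ 2 := by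
      gcongr
      · exact le_abs_self C
      · exact (xiMap n d).le_opNorm _
    _ = |C| * ‖xiMap n d‖ ^ 2 * ‖y - z‖ ^ 2 := by ring

theorem eventually_slackResidual_sub_eq (z : Var n d) :
    ∀ᶠ y in 𝓝 z, ∀ P ∈ jacobianOrthant (S.constraintMap y - S.σ⁻¹ • S.ut),
      S.slackResidual y - S.slackResidual z =
        S.constraintMap (y - z) - Matrix.toEuclideanLin P (S.constraintMap (y - z)) := by
  have hlim : Tendsto (fun y => S.constraintMap (y - z)) (𝓝 z) (𝓝 0) :=
    (S.constraintMap.continuous.comp (continuous_sub_right z)).tendsto' z 0 (by simp)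
  filter_upwards [hlim.eventually
    (eventually_prox_orthant_sub_eq (S.constraintMap z - S.σ⁻¹ • S.ut))] with y hy P hP
  have hadd : S.constraintMap z - S.σ⁻¹ • S.ut + S.constraintMap (y - z) =
      S.constraintMap y - S.σ⁻¹ • S.ut := by
    rw [map_sub]
    abel
  rw [← hy P (by rwa [hadd]), slackResidual, slackResidual, ← hadd]
  abel

theorem hasNewtonDerivativeAt_gradPhi
    (hprox : StronglySemismooth (prox S.p) (clarkeJacobian (prox S.p))) (z : Var n d) :
    HasNewtonDerivativeAt 2 S.gradPhi S.genHessianMaps z := by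
  obtain ⟨C, hC⟩ := exists_eventually_norm_xiResidual_sub_sub_le hprox z
  refine ⟨‖S.hessianMap‖ * C, ?_⟩
  filter_upwards [hC, eventually_slackResidual_sub_eq z] with y hξ hη T hT
  obtain ⟨P, hP, Q, hQ, hTv⟩ := S.exists_eq_hessianMap_of_mem_genHessianMaps hT
  have hnorm (a : EuclideanSpace ℝ (Fin n × Fin d)) :
      ‖((0, a, 0) : Var n d × EuclideanSpace ℝ (Fin n × Fin d) ×
        EuclideanSpace ℝ (Fin n × Fin n))‖ = ‖a‖ := by
    simp [Prod.norm_mk]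
  rw [gradPhi_sub, hTv, ← map_sub, Prod.mk_sub_mk, Prod.mk_sub_mk, sub_self, hη P hP, sub_self,
    Real.rpow_two, mul_assoc]
  refine (S.hessianMap.le_opNorm _).trans ?_
  rw [hnorm]
  gcongr
  exact hξ Q hQ

theorem SSNStep.exists_isNewtonStep {c γ τ δ μ : ℝ} {z z' : Var n d} (hc : 0 < c)
    (hherm : ∀ H ∈ S.genHessian z, H.IsHermitian)
    (hcoer : ∀ T ∈ S.genHessianMaps z, ∀ v, c * ‖v‖ ^ 2 ≤ ⟪T v, v⟫_ℝ)
    (hgrad : HasGradientAt S.Phi (S.gradPhi z) z) (h : S.SSNStep γ τ δ μ z z') :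
    ∃ T ∈ S.genHessianMaps z, ∃ Δ m,
      IsNewtonStep S.Phi S.gradPhi γ τ δ μ T z Δ m ∧ z' = z + δ ^ m • Δ := by
  obtain ⟨H, hH, Δ, hΔ, hres, m, hm, rfl⟩ := h
  rw [hgrad.gradient] at hΔ hres hm
  have hT : Matrix.toEuclideanLin H ∈ S.genHessianMaps z := Set.mem_image_of_mem _ hH
  have hpos : H.PosDef := posDef_of_mul_norm_sq_le_inner (hherm H hH) hc (hcoer _ hT)
  refine ⟨_, hT, Δ, m, ⟨?_, hres, hm⟩, rfl⟩
  simpa only [sub_neg_eq_add] using hΔ.inner_residual hpos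

end Subproblem

end ConvexRegression

theorem theorem3_general {n d : ℕ} (S : Subproblem n d)
    (hD_nonempty : S.D.Nonempty) (hD_closed : IsClosed S.D) (hD_convex : Convex ℝ S.D)
    (hσ : 0 < S.σ) (hH₁ : S.H₁.PosSemidef) (hH₂ : S.H₂.PosDef)
    (hprox : StronglySemismooth (prox S.p) (clarkeJacobian (prox S.p)))
    (γ τ δ μ : ℝ) (hγ : γ ∈ Set.Ioo (0 : ℝ) 1) (hτ : τ ∈ Set.Ioc (0 : ℝ) 1)
    (hδ : δ ∈ Set.Ioo (0 : ℝ) 1) (hμ : μ ∈ Set.Ioo (0 : ℝ) (1 / 2))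
    (z : ℕ → Var n d) (hz : ∀ j, S.SSNStep γ τ δ μ (z j) (z (j + 1))) :
    ∃ zbar : Var n d,
      (∀ w, S.Phi zbar ≤ S.Phi w) ∧
      (∀ y, (∀ w, S.Phi y ≤ S.Phi w) → y = zbar) ∧
      Tendsto z atTop (𝓝 zbar) ∧
      (fun j => ‖z (j + 1) - zbar‖) =O[atTop] (fun j => ‖z j - zbar‖ ^ (1 + τ)) ∧
      (fun j => ‖z (j + 1) - zbar‖) =o[atTop] (fun j => ‖z j - zbar‖) ∧
      (τ = 1 → (fun j => ‖z (j + 1) - zbar‖) =O[atTop] (fun j => ‖z j - zbar‖ ^ 2)) := by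
  have hgrad := Subproblem.hasGradientAt_Phi hD_nonempty hD_closed hD_convex hH₁.1 hH₂.1
  obtain ⟨c, hc, L, hL, hmono, hLip, hT⟩ :=
    Subproblem.exists_stronglyMonotone_and_lipschitzWith_gradPhi hD_nonempty hD_closed hD_convex
      hσ hH₁ hH₂
  obtain ⟨zbar, hbar⟩ := exists_eq_zero_of_stronglyMonotone hmono hc hgrad
  choose T hTmem Δ m hstep hzsucc using fun j => (hz j).exists_isNewtonStep hc
    (fun H hH => Subproblem.isHermitian_of_mem_genHessian hD_nonempty hD_closed hD_convex
      hH₁.1 hH₂.1 hH) (fun T hT' v => (hT _ T hT' v).1) (hgrad (z j))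
  have hlim : Tendsto z atTop (𝓝 zbar) := tendsto_of_isNewtonStep hgrad hL hLip hc hmono hγ hτ.1
    hδ ⟨hμ.1, by linarith [hμ.2]⟩ (fun j v => (hT _ _ (hTmem j) v).1)
    (fun j v => (hT _ _ (hTmem j) v).2) hstep hzsucc hbar
  obtain ⟨D, hD⟩ := exists_hasBouligandDerivAt hLip
    (Subproblem.exists_tendsto_inv_smul_gradPhi_sub hprox zbar)
  have hnewton := ((Subproblem.hasNewtonDerivativeAt_gradPhi hprox zbar).mono
    (q := 1 + τ) (by linarith [hτ.1]) (by linarith [hτ.2])).isBigO hlim hTmem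
  simp only [hbar, sub_zero] at hnewton
  have hrate := isBigO_of_isNewtonStep hgrad hLip hc hmono hτ.1 hμ.2
    (fun j v => (hT _ _ (hTmem j) v).1) hstep hzsucc hbar hlim hD hnewton
  refine ⟨zbar, fun w => ?_, fun y hy => hmono.eq_of_forall_le hc hgrad hbar hy, hlim,
    hrate.norm_left, ?_, fun hτ1 => ?_⟩
  · exact (le_add_of_nonneg_right (by positivity)).trans (hmono.add_le_of_eq_zero hgrad hbar w)
  · exact (isLittleO_of_isBigO_norm_rpow hτ.1 (tendsto_sub_nhds_zero_iff.mpr hlim) hrate).norm_norm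
  · refine hrate.norm_left.congr_right fun j => ?_
    rw [hτ1, one_add_one_eq_two, Real.rpow_two]

theorem theorem3 {n d : ℕ} (S : Subproblem n d)
    (hD_nonempty : S.D.Nonempty) (hD_closed : IsClosed S.D) (hD_convex : Convex ℝ S.D)
    (hσ : 0 < S.σ) (hH₁ : S.H₁.PosDef) (hH₂ : S.H₂.PosDef)
    (hprox : StronglySemismooth (prox S.p) (clarkeJacobian (prox S.p)))
    (γ τ δ μ : ℝ) (hγ : γ ∈ Set.Ioo (0 : ℝ) 1) (hτ : τ ∈ Set.Ioc (0 : ℝ) 1)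
    (hδ : δ ∈ Set.Ioo (0 : ℝ) 1) (hμ : μ ∈ Set.Ioo (0 : ℝ) (1 / 2))
    (z : ℕ → Var n d) (hz : ∀ j, S.SSNStep γ τ δ μ (z j) (z (j + 1))) :
    ∃ zbar : Var n d,
      (∀ w, S.Phi zbar ≤ S.Phi w) ∧
      (∀ y, (∀ w, S.Phi y ≤ S.Phi w) → y = zbar) ∧
      Tendsto z atTop (𝓝 zbar) ∧
      (fun j => ‖z (j + 1) - zbar‖) =O[atTop] (fun j => ‖z j - zbar‖ ^ (1 + τ)) ∧
      (fun j => ‖z (j + 1) - zbar‖) =o[atTop] (fun j => ‖z j - zbar‖) ∧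
      (τ = 1 → (fun j => ‖z (j + 1) - zbar‖) =O[atTop] (fun j => ‖z j - zbar‖ ^ 2)) :=
  theorem3_general S hD_nonempty hD_closed hD_convex hσ hH₁.posSemidef hH₂ hprox γ τ δ μ hγ hτ hδ hμ
    z hz
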